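/- **The Koch chain.** A realization of the Koch chain $K_1$ is the point set $\{(-1,0),(0,-1),(1,0)\}$ in the Euclidean plane. Let $T$ be the triangle with these three vertices. For $s\ge 2$, a realization of $K_s$ is a union $A\cup B$ obtained as follows. Take two realizations $Q_1,Q_2$ of $K_{s-1}$, flatten them vertically, $(x,y)\mapsto(x,\varepsilon_i y)$ with $\varepsilon_i>0$, and apply to them the orientation-preserving similarities that send $(1,0),(-1,0)$ to $(-1,0),(0,-1)$ (giving $A$) and to $(0,-1),(1,0)$ (giving $B$), respectively. The copies are required to be sufficiently flat, in the following sense: - the order of the points along the $x$-axis is the order along the chain (that is, each of the two maps reverses the $x$-order of the points of $Q_i$); - all points of $A\cup B$ other than the three vertices lie in the interior of $T$; - for all $a\in A$, $b\in B$ different from $(0,-1)$, no point of $A\cup B$ other than $a,b$ lies on or vertically above the segment $ab$. **The dual Koch arrangement.** The dual Koch arrangement $K_s^*$ of a realization of $K_s$ is the set of lines $y=ax-b$, one for each point $(a,b)$ of the realization, regarded as lines in the real projective plane. Its faces are the connected components of the complement of the union of the lines. Its edges are the connected components of the lines after removal of their intersection points with the other lines. The number of edges of a face is the number of edges contained in its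 closure; triangles, quadrilaterals and pentagons are faces with 3, 4 and 5 edges. **Theorem.** For every $s\ge1$ realizations of $K_s$ exist; each consists of $2^s+1$ points, and its dual arrangement consists of $2^s+1$ lines. For every $s\ge 3$ and every realization of $K_s$, the arrangement $K_s^*$ in the projective plane has exactly $3\cdot 2^{s-1}-3$ pentagons, and every other face is a triangle or a quadrilateral. In particular, no face has more than five edges. The formula $3\cdot2^{s-1}-3$ for the number of pentagons also holds for $s=1$ (every realization), but fails for $s=2$ (every realization). -/

import Mathlib

open scoped LinearAlgebra.Projectivization

namespace Koch

/-! ### The Koch chain -/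

/-- The three vertices of the initial triangle. -/
def vLeft : ℝ × ℝ := (-1, 0)

/-- The lower vertex of the initial triangle, common to the two copies. -/
def vMid : ℝ × ℝ := (0, -1)

/-- The right vertex of the initial triangle. -/
def vRight : ℝ × ℝ := (1, 0)

/-- Flattening `(x, y) ↦ (x, ε y)` along the vertical direction. -/
def flatten (ε : ℝ) (q : ℝ × ℝ) : ℝ × ℝ := (q.1, ε * q.2)

/-- The orientation preserving similarity which sends `(1, 0)` to `vLeft` and `(-1, 0)` to `vMid`
(rotation by 135 degrees, scaling by `1 / √2`, translation). It turns points below the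
segment from `(-1, 0)` to `(1, 0)` to the side of the edge `vLeft vMid` on which `vRight` lies. -/
noncomputable def placeLeft (q : ℝ × ℝ) : ℝ × ℝ :=
  (-1 / 2 - q.1 / 2 - q.2 / 2, -1 / 2 + q.1 / 2 - q.2 / 2)

/-- The orientation preserving similarity which sends `(1, 0)` to `vMid` and `(-1, 0)` to `vRight`
(rotation by 225 degrees, scaling by `1 / √2`, translation). It turns points below the
segment from `(-1, 0)` to `(1, 0)` to the side of the edge `vMid vRight` on which `vLeft` lies. -/
noncomputable def placeRight (q : ℝ × ℝ) : ℝ × ℝ :=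
  (1 / 2 - q.1 / 2 + q.2 / 2, -1 / 2 - q.1 / 2 - q.2 / 2)

/-- The left copy of `Q`, flattened by `ε`. -/
noncomputable def leftCopy (ε : ℝ) (q : ℝ × ℝ) : ℝ × ℝ := placeLeft (flatten ε q)

/-- The right copy of `Q`, flattened by `ε`. -/
noncomputable def rightCopy (ε : ℝ) (q : ℝ × ℝ) : ℝ × ℝ := placeRight (flatten ε q)

/-- The upper shadow of the segment `ab`: the points on or vertically above the segment. -/
def upperShadow (a b : ℝ × ℝ) : Set (ℝ × ℝ) :=
  {p | ∃ z ∈ segment ℝ a b, z.1 = p.1 ∧ z.2 ≤ p.2}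

/-- The left copy `A` and the right copy `B` have no third point in the upper shadow of any segment
that joins a point of `A` to a point of `B`, where the common point `vMid` is excluded as an
endpoint. -/
def NoPointInUpperShadow (A B : Set (ℝ × ℝ)) : Prop :=
  ∀ a ∈ A, ∀ b ∈ B, a ≠ vMid → b ≠ vMid →
    ∀ p ∈ A ∪ B, p ≠ a → p ≠ b → p ∉ upperShadow a b

/-- `IsKochChain s P`: the planar point set `P` is a realization of the Koch chain `K_s`, `s ≥ 1`.
Two (realizations of the) copies of `K_s` are flattened by factors `ε₁, ε₂ > 0` and placed on the
two lower edges of the triangle, and they have to be sufficiently flat: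
the order of the points along the `x`-axis is the order along the chain (the rotations reverse it
within each copy), all points except the three vertices lie in the interior of the triangle,
and segments between the two copies have no third point in their upper shadow. -/
inductive IsKochChain : ℕ → Set (ℝ × ℝ) → Prop
  | base : IsKochChain 1 {vLeft, vMid, vRight}
  | step (s : ℕ) (Q₁ Q₂ : Set (ℝ × ℝ)) (ε₁ ε₂ : ℝ)
      (hQ₁ : IsKochChain s Q₁) (hQ₂ : IsKochChain s Q₂) (hε₁ : 0 < ε₁) (hε₂ : 0 < ε₂)
      (horder₁ : ∀ q ∈ Q₁, ∀ q' ∈ Q₁, q.1 < q'.1 → (leftCopy ε₁ q').1 < (leftCopy ε₁ q).1)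
      (horder₂ : ∀ q ∈ Q₂, ∀ q' ∈ Q₂, q.1 < q'.1 → (rightCopy ε₂ q').1 < (rightCopy ε₂ q).1)
      (hinterior : ∀ p ∈ leftCopy ε₁ '' Q₁ ∪ rightCopy ε₂ '' Q₂,
        p ∉ ({vLeft, vMid, vRight} : Set (ℝ × ℝ)) →
          p ∈ interior (convexHull ℝ ({vLeft, vMid, vRight} : Set (ℝ × ℝ))))
      (hshadow : NoPointInUpperShadow (leftCopy ε₁ '' Q₁) (rightCopy ε₂ '' Q₂)) :
      IsKochChain (s + 1) (leftCopy ε₁ '' Q₁ ∪ rightCopy ε₂ '' Q₂)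

/-! ### Line arrangements in the projective plane -/

/-- The real projective plane. The point `(x, y)` of the Euclidean plane is the point
`[x : y : 1]`. -/
abbrev ProjPlane : Type := ℙ ℝ (Fin 3 → ℝ)

/-- The quotient topology of `ℝ³ ∖ {0}` on the projective plane. -/
instance : TopologicalSpace ProjPlane :=
  inferInstanceAs (TopologicalSpace (Quotient (projectivizationSetoid ℝ (Fin 3 → ℝ))))

/-- The line `y = a x - b` dual to the point `(a, b)`, as a line in the projective plane, with
homogeneous equation `a X - Y - b Z = 0` (the choice of the representative does not matter). -/
def dualLine (p : ℝ × ℝ) : Set ProjPlane :=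
  {P | p.1 * P.rep 0 - P.rep 1 - p.2 * P.rep 2 = 0}

theorem mk_mem_dualLine (p : ℝ × ℝ) (v : Fin 3 → ℝ) (hv : v ≠ 0) :
    Projectivization.mk ℝ v hv ∈ dualLine p ↔ p.1 * v 0 - v 1 - p.2 * v 2 = 0 := by
  obtain ⟨c, hc⟩ := Projectivization.exists_smul_eq_mk_rep ℝ v hv
  have h0 : (c : ℝ) ≠ 0 := c.ne_zero
  have e : ∀ i, (Projectivization.mk ℝ v hv).rep i = c * v i := by
    intro i
    rw [← hc]
    rfl
  have key : p.1 * (c * v 0) - c * v 1 - p.2 * (c * v 2)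
      = (c : ℝ) * (p.1 * v 0 - v 1 - p.2 * v 2) := by ring
  simp only [dualLine, Set.mem_ofPred_eq, e]
  rw [key, mul_eq_zero]
  simp [h0]

/-- In the affine plane, `dualLine (a, b)` is the line `y = a x - b`. -/
theorem affine_mem_dualLine (a b x y : ℝ) (hv : (![x, y, 1] : Fin 3 → ℝ) ≠ 0) :
    Projectivization.mk ℝ ![x, y, 1] hv ∈ dualLine (a, b) ↔ y = a * x - b := by
  rw [mk_mem_dualLine]
  simp
  constructor <;> intro h <;> linarith

/-- The arrangement of the lines dual to the points of `P`. -/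
def dualArrangement (P : Set (ℝ × ℝ)) : Set (Set ProjPlane) := dualLine '' P

/-- The faces of an arrangement `A` of lines in the projective plane: the connected components of
the complement of the union of the lines. -/
def IsFace (A : Set (Set ProjPlane)) (F : Set ProjPlane) : Prop :=
  ∃ x ∈ (⋃₀ A)ᶜ, F = connectedComponentIn (⋃₀ A)ᶜ x

/-- The edges of an arrangement `A`: the connected components of what remains of a line of `A` when
its intersection points with the other lines of `A` are removed. -/
def IsEdge (A : Set (Set ProjPlane)) (e : Set ProjPlane) : Prop :=
  ∃ l ∈ A, ∃ x ∈ l \ ⋃₀ (A \ {l}), e = connectedComponentIn (l \ ⋃₀ (A \ {l})) x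

/-- The number of edges of the face `F` of `A`: the number of edges of `A` on its boundary. -/
noncomputable def numEdges (A : Set (Set ProjPlane)) (F : Set ProjPlane) : ℕ∞ :=
  {e | IsEdge A e ∧ e ⊆ closure F}.encard

/-- The pentagons of an arrangement: its faces with exactly five edges. -/
def pentagons (A : Set (Set ProjPlane)) : Set (Set ProjPlane) :=
  {F | IsFace A F ∧ numEdges A F = 5}

end Koch

namespace Koch

/-! By duality a point of the dual plane is a line of the primal plane, and a face is the class of
lines that have the same set `U` of points above them. In the projective plane `U` is only
determined up to complement, because a line that turns through the vertical exchanges above and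
below. The face has an edge on the line dual to `p` if some line through `p` splits the remaining
points as `U` does. Hence everything depends on the order type alone.

The flatness conditions determine the order type (`IsKochChain.exists_realization`). The line
through a point of each copy has exactly the points strictly between them below it. A line through
two points of one copy has the rest of the other copy above it. Inside a copy orientations are
preserved and the x-order is reversed, so above and below are interchanged. This is the recursion
`Above`.

Apart from the triangle with all points on one side (`isFaceCycle_true`), each face is obtained from
exactly one pair `i < j`, by turning the line `ij` slightly counterclockwise: `ij` is the limit line
of least slope (`IsRealization.exists_rotated`, `IsRealization.rotated_injective`). Classes that
contain arbitrarily steep lines separate the points at a gap `k`, `k + 1`; such a face consists of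
two ends, which are joined through the vertical lines.

The boundaries are found recursively (`shape_spec`). A pair that straddles the middle point yields a
quadrilateral `i, i + 1, j, j + 1`, except next to the middle point or at the last point. Bounded
faces of the copies survive. An end of a gap of a copy either stays unbounded or is closed, in
general by one further line. An end has at most four lines (`exists_halfFace`), which leads to at
most five edges. That a closed cycle of vertices lists all the edges of a face is a linear
programming argument (`facets_of_cycle`).

For the count, exactly `s` gaps of `K_(s+1)` have an end with four lines (`fourHalves_eq`). Bounded
pentagons double from level to level, with two more for each such gap and one more at the middle
(`boundedPentagons_succ`). The unbounded pentagons (`sum_gaps`) cancel the linear term in the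
solution of this recursion. -/

/-! ### The order type of the Koch chain -/

/-- `Above s p q r`: in the Koch chain `K_s`, with points numbered `0, …, 2 ^ s` from left to right,
the point `r` lies above the line through the points `p` and `q`. -/
def Above : ℕ → ℕ → ℕ → ℕ → Prop
  -- The recursion starts with a chain of two points, which has no third point; the value here is
  -- never consulted for three distinct points.
  | 0, _, _, _ => True
  | s + 1, p, q, r =>
    if (p < 2 ^ s ∧ 2 ^ s < q) ∨ (q < 2 ^ s ∧ 2 ^ s < p) then ¬ (min p q < r ∧ r < max p q)
    else if p ≤ 2 ^ s ∧ q ≤ 2 ^ s then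
      (r ≤ 2 ^ s → ¬ Above s (2 ^ s - p) (2 ^ s - q) (2 ^ s - r))
    else (2 ^ s ≤ r → ¬ Above s (2 * 2 ^ s - p) (2 * 2 ^ s - q) (2 * 2 ^ s - r))

theorem two_pow_succ' (s : ℕ) : 2 ^ (s + 1) = 2 * 2 ^ s := by rw [pow_succ, mul_comm]

theorem above_symm (s p q r : ℕ) : Above s p q r ↔ Above s q p r := by
  induction s generalizing p q r with
  | zero => rfl
  | succ s ih =>
    simp only [Above]
    rw [ih (2 ^ s - p), ih (2 * 2 ^ s - p), min_comm, max_comm]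
    split_ifs <;> first | rfl | omega

theorem above_mixed {s p q r : ℕ} (hp : p < 2 ^ s) (hq : 2 ^ s < q) :
    Above (s + 1) p q r ↔ ¬ (p < r ∧ r < q) := by
  simp only [Above]
  rw [if_pos (Or.inl ⟨hp, hq⟩), min_eq_left (by omega), max_eq_right (by omega)]

theorem above_left {s p q r : ℕ} (hp : p ≤ 2 ^ s) (hq : q ≤ 2 ^ s) :
    Above (s + 1) p q r ↔ (r ≤ 2 ^ s → ¬ Above s (2 ^ s - p) (2 ^ s - q) (2 ^ s - r)) := by
  simp only [Above]
  rw [if_neg (by omega), if_pos ⟨hp, hq⟩]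

theorem above_right {s p q r : ℕ} (hp : 2 ^ s ≤ p) (hq : 2 ^ s ≤ q) (hpq : p ≠ q) :
    Above (s + 1) p q r ↔
      (2 ^ s ≤ r → ¬ Above s (2 * 2 ^ s - p) (2 * 2 ^ s - q) (2 * 2 ^ s - r)) := by
  simp only [Above]
  rw [if_neg (by omega), if_neg (by omega)]

/-- The reflection exchanges the two copies, and the reversal inside each copy is absorbed by the
same symmetry one level below. -/
theorem above_mirror {s p q r : ℕ} (hp : p ≤ 2 ^ s) (hq : q ≤ 2 ^ s) (hr : r ≤ 2 ^ s)
    (hpq : p ≠ q) : Above s (2 ^ s - p) (2 ^ s - q) (2 ^ s - r) ↔ Above s p q r := by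
  induction s generalizing p q r with
  | zero => rfl
  | succ s ih =>
    rw [two_pow_succ'] at *
    wlog h : p < q generalizing p q
    · rw [above_symm, above_symm _ p]
      exact this hq hp hpq.symm (by omega)
    rcases lt_or_ge p (2 ^ s) with h1 | h1
    · rcases lt_or_ge (2 ^ s) q with h2 | h2
      · rw [above_symm, above_mixed (by omega) (by omega), above_mixed h1 h2]
        omega
      · rw [above_right (by omega) (by omega) (by omega), above_left (by omega) (by omega),
          Nat.sub_sub_self hp, Nat.sub_sub_self hq, Nat.sub_sub_self hr]
        constructor <;> intro H hr'
        · rw [ih (by omega) (by omega) (by omega) hpq]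
          exact H (by omega)
        · rw [← ih (by omega) (by omega) (by omega) hpq]
          exact H (by omega)
    · have e : ∀ x, x ≤ 2 * 2 ^ s → 2 ^ s - (2 * 2 ^ s - x) = x - 2 ^ s := by intros; omega
      have e' : ∀ x, 2 ^ s ≤ x → x ≤ 2 * 2 ^ s → 2 ^ s - (x - 2 ^ s) = 2 * 2 ^ s - x := by
        intros; omega
      rw [above_left (by omega) (by omega), above_right (by omega) (by omega) (by omega),
        e p hp, e q hq, e r hr]
      constructor <;> intro H hr'
      · rw [← e' p (by omega) (by omega), ← e' q (by omega) (by omega), ← e' r (by omega) (by omega),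
          ih (by omega) (by omega) (by omega) (by omega)]
        exact H (by omega)
      · rw [← ih (by omega) (by omega) (by omega) (by omega), e' p (by omega) (by omega),
          e' q (by omega) (by omega), e' r (by omega) (by omega)]
        exact H (by omega)

theorem not_above_ends {s r : ℕ} (h0 : 0 < r) (h1 : r < 2 ^ s) : ¬ Above s 0 (2 ^ s) r := by
  cases s with
  | zero => simp at h1; omega
  | succ s =>
    have := Nat.two_pow_pos s
    rw [above_mixed (by omega) (by omega)]
    omega

/-- A chain hangs below the segment between its ends. In a copy this is turned upside down, so the
two lower sides of the triangle are edges of the convex hull. -/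
theorem above_left_ends {s r : ℕ} (h0 : r ≠ 0) (h1 : r ≠ 2 ^ s) : Above (s + 1) 0 (2 ^ s) r := by
  have := Nat.two_pow_pos s
  rw [above_left (by omega) (by omega)]
  intro hr
  rw [above_symm, Nat.sub_zero, Nat.sub_self]
  exact not_above_ends (by omega) (by omega)

theorem above_right_ends {s r : ℕ} (hr : r ≤ 2 * 2 ^ s) (h0 : r ≠ 2 * 2 ^ s) (h1 : r ≠ 2 ^ s) :
    Above (s + 1) (2 ^ s) (2 * 2 ^ s) r := by
  have := Nat.two_pow_pos s
  rw [above_right (by omega) (by omega) (by omega)]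
  intro hr
  rw [above_symm, Nat.sub_self, two_mul, Nat.add_sub_cancel]
  exact not_above_ends (by omega) (by omega)

/-! ### Vertices of faces -/

/-- The vertex of the dual arrangement given by the line through `p` and `q` is in the closure of
the face of the lines that have precisely the points in `U` above them. -/
def IsVertex (s : ℕ) (U : ℕ → Prop) (p q : ℕ) : Prop :=
  p ≤ 2 ^ s ∧ q ≤ 2 ^ s ∧ p ≠ q ∧ ∀ r ≤ 2 ^ s, r ≠ p → r ≠ q → (U r ↔ Above s p q r)

theorem IsVertex.symm {s : ℕ} {U : ℕ → Prop} {p q : ℕ} (h : IsVertex s U p q) :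
    IsVertex s U q p :=
  ⟨h.2.1, h.1, h.2.2.1.symm, fun r hr h1 h2 => by
    rw [above_symm]; exact h.2.2.2 r hr h2 h1⟩

theorem IsVertex.congr {s : ℕ} {U W : ℕ → Prop} {p q : ℕ} (h : IsVertex s U p q)
    (hUW : ∀ r ≤ 2 ^ s, (W r ↔ U r)) : IsVertex s W p q :=
  ⟨h.1, h.2.1, h.2.2.1, fun r hr h1 h2 => (hUW r hr).trans (h.2.2.2 r hr h1 h2)⟩

/-- The points above a line near the left copy of `K_s`. -/
def flipLeft (s : ℕ) (U : ℕ → Prop) (r : ℕ) : Prop := r ≤ 2 ^ s → ¬ U (2 ^ s - r)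

/-- The points above a line near the right copy of `K_s`. -/
def flipRight (s : ℕ) (U : ℕ → Prop) (r : ℕ) : Prop := 2 ^ s ≤ r → ¬ U (2 * 2 ^ s - r)

theorem IsVertex.left {s : ℕ} {U : ℕ → Prop} {p q : ℕ} (h : IsVertex s U p q) :
    IsVertex (s + 1) (flipLeft s U) (2 ^ s - p) (2 ^ s - q) := by
  obtain ⟨hp, hq, hpq, h⟩ := h
  rw [IsVertex, two_pow_succ']
  refine ⟨by omega, by omega, by omega, fun r hr h1 h2 => ?_⟩
  rw [above_left (by omega) (by omega), Nat.sub_sub_self hp, Nat.sub_sub_self hq, flipLeft]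
  refine forall_congr' fun hr' => not_congr (h _ (by omega) (by omega) (by omega))

theorem IsVertex.right {s : ℕ} {U : ℕ → Prop} {p q : ℕ} (h : IsVertex s U p q) :
    IsVertex (s + 1) (flipRight s U) (2 * 2 ^ s - p) (2 * 2 ^ s - q) := by
  obtain ⟨hp, hq, hpq, h⟩ := h
  rw [IsVertex, two_pow_succ']
  refine ⟨by omega, by omega, by omega, fun r hr h1 h2 => ?_⟩
  rw [above_right (by omega) (by omega) (by omega), Nat.sub_sub_self (by omega),
    Nat.sub_sub_self (by omega), flipRight]
  refine forall_congr' fun hr' => not_congr (h _ (by omega) (by omega) (by omega))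

theorem IsVertex.mirror {s : ℕ} {U : ℕ → Prop} {p q : ℕ} (h : IsVertex s U p q) :
    IsVertex s (fun r => U (2 ^ s - r)) (2 ^ s - p) (2 ^ s - q) := by
  obtain ⟨hp, hq, hpq, h⟩ := h
  refine ⟨by omega, by omega, by omega, fun r hr h1 h2 => ?_⟩
  refine (h _ (by omega) (by omega) (by omega)).trans ?_
  rw [← above_mirror hp hq (by omega) hpq, Nat.sub_sub_self hr]

/-- Two vertices of the face `U` join `p` to points of `T`. -/
def TwoVertices (s : ℕ) (U : ℕ → Prop) (T : Finset ℕ) (p : ℕ) : Prop :=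
  ∃ q ∈ T, ∃ q' ∈ T, q ≠ q' ∧ IsVertex s U p q ∧ IsVertex s U p q'

/-- The points of `T` form a closed cycle of vertices of the face `U`, all of which belong to
non-vertical lines that have the points of `U` above them. -/
def IsBoundedFace (s : ℕ) (U : ℕ → Prop) (T : Finset ℕ) : Prop :=
  T.Nonempty ∧ ∀ p ∈ T, TwoVertices s U T p

/-- The points of `T` form a path of vertices of the face `U` from `k` to `k + 1`. -/
def IsHalfFace (s : ℕ) (U : ℕ → Prop) (k : ℕ) (T : Finset ℕ) : Prop :=
  k ∈ T ∧ k + 1 ∈ T ∧ (∃ q ∈ T, IsVertex s U k q) ∧ (∃ q ∈ T, IsVertex s U (k + 1) q) ∧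
    ∀ p ∈ T, p ≠ k → p ≠ k + 1 → TwoVertices s U T p

theorem TwoVertices.mono {s : ℕ} {U W : ℕ → Prop} {T T' : Finset ℕ} {p : ℕ}
    (h : TwoVertices s U T p) (hT : T ⊆ T') (hUW : ∀ r ≤ 2 ^ s, (W r ↔ U r)) :
    TwoVertices s W T' p := by
  obtain ⟨q, hq, q', hq', hne, h1, h2⟩ := h
  exact ⟨q, hT hq, q', hT hq', hne, h1.congr hUW, h2.congr hUW⟩

theorem TwoVertices.map {s t : ℕ} {U W : ℕ → Prop} {T : Finset ℕ} {p : ℕ} (f : ℕ → ℕ)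
    (h : TwoVertices s U T p)
    (hf : ∀ p q, IsVertex s U p q → IsVertex t W (f p) (f q))
    (hinj : ∀ p q, p ≤ 2 ^ s → q ≤ 2 ^ s → f p = f q → p = q) :
    TwoVertices t W (T.image f) (f p) := by
  obtain ⟨q, hq, q', hq', hne, h1, h2⟩ := h
  exact ⟨_, Finset.mem_image_of_mem f hq, _, Finset.mem_image_of_mem f hq',
    fun e => hne (hinj _ _ h1.2.1 h2.2.1 e), hf _ _ h1, hf _ _ h2⟩

theorem TwoVertices.le {s : ℕ} {U : ℕ → Prop} {T : Finset ℕ} {p : ℕ}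
    (h : TwoVertices s U T p) : p ≤ 2 ^ s := by
  obtain ⟨q, hq, q', hq', hne, h1, h2⟩ := h
  exact h1.1

theorem IsHalfFace.le {s : ℕ} {U : ℕ → Prop} {T : Finset ℕ} {k : ℕ}
    (h : IsHalfFace s U k T) {p : ℕ} (hp : p ∈ T) : p ≤ 2 ^ s := by
  obtain ⟨_, _, ⟨_, _, h1⟩, ⟨_, _, h2⟩, h⟩ := h
  by_cases hk : p = k
  · exact hk ▸ h1.1
  by_cases hk' : p = k + 1
  · exact hk' ▸ h2.1
  exact (h p hp hk hk').le

theorem IsHalfFace.congr {s : ℕ} {U W : ℕ → Prop} {k : ℕ} {T : Finset ℕ} (h : IsHalfFace s U k T)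
    (hUW : ∀ r ≤ 2 ^ s, (W r ↔ U r)) : IsHalfFace s W k T := by
  obtain ⟨hk, hk', ⟨q1, hq1, h1⟩, ⟨q2, hq2, h2⟩, h⟩ := h
  exact ⟨hk, hk', ⟨q1, hq1, h1.congr hUW⟩, ⟨q2, hq2, h2.congr hUW⟩,
    fun p hp e1 e2 => (h p hp e1 e2).mono subset_rfl hUW⟩

theorem IsBoundedFace.map {s t : ℕ} {U W : ℕ → Prop} {T : Finset ℕ} (f : ℕ → ℕ)
    (h : IsBoundedFace s U T)
    (hf : ∀ p q, IsVertex s U p q → IsVertex t W (f p) (f q))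
    (hinj : ∀ p q, p ≤ 2 ^ s → q ≤ 2 ^ s → f p = f q → p = q) :
    IsBoundedFace t W (T.image f) := by
  refine ⟨h.1.image f, fun p hp => ?_⟩
  obtain ⟨x, hx, rfl⟩ := Finset.mem_image.1 hp
  exact (h.2 x hx).map f hf hinj

/-- A half face is mapped to a half face by a map that reverses the order of `k` and `k + 1`. -/
theorem IsHalfFace.map {s t : ℕ} {U W : ℕ → Prop} {k k' : ℕ} {T : Finset ℕ} (f : ℕ → ℕ)
    (h : IsHalfFace s U k T)
    (hf : ∀ p q, IsVertex s U p q → IsVertex t W (f p) (f q))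
    (hinj : ∀ p q, p ≤ 2 ^ s → q ≤ 2 ^ s → f p = f q → p = q)
    (hk : f k = k' + 1) (hk' : f (k + 1) = k') :
    IsHalfFace t W k' (T.image f) := by
  obtain ⟨h0, h0', ⟨q1, hq1, h1⟩, ⟨q2, hq2, h2⟩, h⟩ := h
  refine ⟨hk' ▸ Finset.mem_image_of_mem f h0', hk ▸ Finset.mem_image_of_mem f h0,
    ⟨f q2, Finset.mem_image_of_mem f hq2, hk' ▸ hf _ _ h2⟩,
    ⟨f q1, Finset.mem_image_of_mem f hq1, hk ▸ hf _ _ h1⟩, fun p hp e1 e2 => ?_⟩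
  obtain ⟨x, hx, rfl⟩ := Finset.mem_image.1 hp
  exact (h x hx (by rintro rfl; exact e2 hk) (by rintro rfl; exact e1 hk')).map f hf hinj

/-- A reflection turns steep rising lines into steep falling ones, and therefore exchanges the two
ends of an unbounded face. -/
theorem IsHalfFace.mirror {s : ℕ} {k k' : ℕ} {T : Finset ℕ} (h : IsHalfFace s (· ≤ k) k T)
    (hk : k + k' + 1 = 2 ^ s) :
    IsHalfFace s (k' < ·) k' (T.image (2 ^ s - ·)) := by
  refine IsHalfFace.map (2 ^ s - ·) h (fun p q hv => hv.mirror.congr fun r hr => ?_)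
    (fun p q hp hq e => ?_) ?_ ?_ <;> grind

theorem card_image_sub {T : Finset ℕ} {M N : ℕ} (hT : ∀ p ∈ T, p ≤ M) (hM : M ≤ N) :
    (T.image (N - ·)).card = T.card :=
  Finset.card_image_of_injOn fun p hp q hq e => by
    have := hT p hp
    have := hT q hq
    have : N - p = N - q := e
    omega

/-! ### The faces of the dual Koch arrangement -/

/-- The number of lines on the right end of the unbounded face between the lines of `k` and `k + 1`
(at the right end). -/
def halfCard : ℕ → ℕ → ℕ
  | 0, _ => 2
  | s + 1, k =>
    if k + 1 < 2 ^ s then 3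
    else if k + 1 = 2 ^ s then (if s = 0 then 3 else 4)
    else halfCard s (2 * 2 ^ s - 1 - k)

/-- The points that lie above the line through `i` and `j`, `i < j`, after a small counterclockwise
rotation about the midpoint of the segment `ij`. -/
def rotated (s i j : ℕ) (r : ℕ) : Prop := r = i ∨ (r ≠ j ∧ Above s i j r)

/-- The shape of the face `rotated s i j`: a bounded face with `e` edges (`inl e`), or the face of
the vertical lines between `k` and `k + 1` (`inr k`). -/
def shape : ℕ → ℕ → ℕ → ℕ ⊕ ℕ
  | 0, _, _ => .inr 0
  | s + 1, i, j =>
    if i < 2 ^ s ∧ 2 ^ s < j then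
      if j = 2 * 2 ^ s then .inr i
      else if i + 1 < 2 ^ s then .inl 4
      else .inl (halfCard s (j - 2 ^ s) + 1)
    else if j ≤ 2 ^ s then
      (shape s (2 ^ s - j) (2 ^ s - i)).elim .inl
        fun k => .inl (if k = 0 then 2 * halfCard s 0 - 1 else halfCard s k + 1)
    else (shape s (2 * 2 ^ s - j) (2 * 2 ^ s - i)).elim .inl fun k => .inr (2 * 2 ^ s - 1 - k)

/-- Lines that separate at the gap with the left part above are rising; flattening them is
obstructed by the points further right. If the gap ends before the middle point, the last point is
the only further obstruction. If it ends at the middle point, the upper hull of the right copy takes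
part. A gap of the right copy is treated there, since the left copy lies above all lines concerned.
The last two clauses localize the path; they show later that the two ends of a gap share only the
lines of `k` and `k + 1`. -/
theorem exists_halfFace {s k : ℕ} (hk : k < 2 ^ s) :
    ∃ T, IsHalfFace s (· ≤ k) k T ∧ T.card = halfCard s k ∧
      (2 * k + 1 < 2 ^ s → ∀ x ∈ T, 2 * x ≤ 2 ^ s → x = k ∨ x = k + 1) ∧
      (2 ^ s < 2 * k + 1 → ∀ x ∈ T, 2 ^ s ≤ 2 * x) := by
  induction s generalizing k with
  | zero =>
    obtain rfl : k = 0 := by simpa using hk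
    have h : IsVertex 0 (· ≤ 0) 0 1 :=
      ⟨by simp, by simp, by simp, fun r hr h1 h2 => by simp at hr; omega⟩
    refine ⟨{0, 1}, ⟨by simp, by simp, ⟨1, by simp, h⟩, ⟨0, by simp, h.symm⟩, ?_⟩,
      by simp [halfCard], by simp, by simp⟩
    simp
  | succ s ih =>
    have hm := Nat.two_pow_pos s
    have e := two_pow_succ' s
    have hv : ∀ i < 2 ^ s, (i = k ∨ i = k + 1) → IsVertex (s + 1) (· ≤ k) i (2 * 2 ^ s) := by
      intro i hi hik
      refine ⟨by omega, by omega, by omega, fun r hr h1 h2 => ?_⟩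
      rw [above_mixed hi (by omega)]
      omega
    rcases lt_trichotomy (k + 1) (2 ^ s) with h | h | h
    · refine ⟨{k, k + 1, 2 * 2 ^ s}, ⟨by simp, by simp,
        ⟨_, by simp, hv k (by omega) (.inl rfl)⟩, ⟨_, by simp, hv _ h (.inr rfl)⟩, ?_⟩, ?_, ?_, ?_⟩
      · intro p hp h1 h2
        obtain rfl : p = 2 * 2 ^ s := by simpa [h1, h2] using hp
        exact ⟨k, by simp, k + 1, by simp, by simp, (hv k (by omega) (.inl rfl)).symm,
          (hv _ h (.inr rfl)).symm⟩
      · rw [Finset.card_eq_three.2 ⟨k, k + 1, 2 * 2 ^ s, by omega, by omega, by omega, rfl⟩]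
        simp [halfCard, h]
      · intro _ x hx
        simp at hx
        omega
      · omega
    · cases s with
      | zero =>
        obtain rfl : k = 0 := by simpa using h
        have h2 : IsVertex 1 (· ≤ 0) 1 2 := by
          refine ⟨by simp, by simp, by simp, fun r hr h1 h2 => ?_⟩
          rw [above_right (by simp) (by simp) (by simp)]
          simp at hr ⊢
          omega
        have hv0 := hv 0 (by simp) (.inl rfl)
        simp only [pow_zero, mul_one, zero_add] at hv0
        refine ⟨{0, 1, 2}, ⟨by simp, by simp, ⟨2, by simp, hv0⟩, ⟨2, by simp, h2⟩, ?_⟩,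
          by simp [halfCard], ?_, by simp⟩
        · intro p hp e1 e2
          obtain rfl : p = 2 := by simpa [e1, e2] using hp
          exact ⟨0, by simp, 1, by simp, by simp, hv0.symm, h2.symm⟩
        · intro _ x hx
          simp at hx ⊢
          omega
      | succ s =>
        have hm' := Nat.two_pow_pos s
        have e' := two_pow_succ' s
        -- The point `3 * 2 ^ s` is the middle of the right copy. As this copy is upside down, its
        -- upper hull is the path through its first point, its middle and its last point.
        have h1 : IsVertex (s + 1 + 1) (· ≤ k) (2 * 2 ^ (s + 1)) (3 * 2 ^ s) := by
          refine ⟨by omega, by omega, by omega, fun r hr h1 h2 => ?_⟩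
          rw [above_right (by omega) (by omega) (by omega), Nat.sub_self,
            show 2 * 2 ^ (s + 1) - 3 * 2 ^ s = 2 ^ s by omega]
          have := @above_left_ends s (2 * 2 ^ (s + 1) - r) (by omega) (by omega)
          simp only [this, not_true, imp_false]
          omega
        have h2 : IsVertex (s + 1 + 1) (· ≤ k) (3 * 2 ^ s) (2 ^ (s + 1)) := by
          refine ⟨by omega, by omega, by omega, fun r hr h1 h2 => ?_⟩
          rw [above_right (by omega) (by omega) (by omega),
            show 2 * 2 ^ (s + 1) - 3 * 2 ^ s = 2 ^ s by omega,
            show 2 * 2 ^ (s + 1) - 2 ^ (s + 1) = 2 * 2 ^ s by omega]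
          by_cases hr' : 2 ^ (s + 1) ≤ r
          · have := @above_right_ends s (2 * 2 ^ (s + 1) - r) (by omega) (by omega) (by omega)
            simp only [this, not_true, imp_false]
            omega
          · simp only [hr', false_imp_iff, iff_true]
            omega
        have h0 := hv k (by omega) (.inl rfl)
        rw [← h] at h2
        refine ⟨{k, k + 1, 3 * 2 ^ s, 2 * 2 ^ (s + 1)}, ⟨by simp, by simp, ⟨_, by simp, h0⟩,
          ⟨_, by simp, h2.symm⟩, ?_⟩, ?_, ?_, ?_⟩
        · intro p hp e1 e2
          have : p = 3 * 2 ^ s ∨ p = 2 * 2 ^ (s + 1) := by simpa [e1, e2] using hp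
          rcases this with rfl | rfl
          · exact ⟨k + 1, by simp, 2 * 2 ^ (s + 1), by simp, by omega, h2, h1.symm⟩
          · exact ⟨k, by simp, 3 * 2 ^ s, by simp, by omega, h0.symm, h1⟩
        · rw [Finset.card_insert_of_notMem, Finset.card_insert_of_notMem,
            Finset.card_insert_of_notMem, Finset.card_singleton]
          · simp [halfCard, h]
          all_goals simp; omega
        · intro _ x hx
          simp at hx
          omega
        · omega
    · obtain ⟨T, hT, hc, -⟩ := @ih (2 * 2 ^ s - 1 - k) (by omega)
      have hle := fun p hp => @IsHalfFace.le _ _ T _ hT p hp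
      refine ⟨T.image (2 * 2 ^ s - ·), ?_, ?_, by omega, ?_⟩
      · refine hT.map _ (fun p q h => h.right.congr fun r hr => ?_) (fun p q hp hq h => ?_) ?_ ?_
        · simp only [flipRight]; omega
        · have : 2 * 2 ^ s - p = 2 * 2 ^ s - q := h
          omega
        · omega
        · omega
      · rw [card_image_sub hle (by omega), hc]
        simp only [halfCard]
        rw [if_neg (by omega), if_neg (by omega)]
      · intro _ x hx
        obtain ⟨y, hy, rfl⟩ := Finset.mem_image.1 hx
        have := hle y hy
        omega

theorem exists_leftHalfFace {s k : ℕ} (hk : k < 2 ^ s) :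
    ∃ T, IsHalfFace s (k < ·) k T ∧ T.card = halfCard s (2 ^ s - 1 - k) ∧
      (2 ^ s < 2 * k + 1 → ∀ x ∈ T, 2 ^ s ≤ 2 * x → x = k ∨ x = k + 1) ∧
      (2 * k + 1 < 2 ^ s → ∀ x ∈ T, 2 * x ≤ 2 ^ s) := by
  obtain ⟨T, hT, hc, h1, h2⟩ := @exists_halfFace s (2 ^ s - 1 - k) (by omega)
  have hle := fun p hp => @IsHalfFace.le _ _ T _ hT p hp
  refine ⟨T.image (2 ^ s - ·), hT.mirror (by omega), ?_, ?_, ?_⟩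
  · rw [card_image_sub hle le_rfl, hc]
  · intro h x hx
    obtain ⟨y, hy, rfl⟩ := Finset.mem_image.1 hx
    have := hle y hy
    have := h1 (by omega) y hy
    omega
  · intro h x hx
    obtain ⟨y, hy, rfl⟩ := Finset.mem_image.1 hx
    have := hle y hy
    have := h2 (by omega) y hy
    omega

/-- The reversal swaps the roles of the two end points and the complement swaps above and below;
together they keep the left end point above. Thus the labelling of faces by pairs is compatible with
the recursion. -/
theorem rotated_left {s i j : ℕ} (hij : i < j) (hj : j ≤ 2 ^ s) (r : ℕ) :
    rotated (s + 1) i j r ↔ flipLeft s (rotated s (2 ^ s - j) (2 ^ s - i)) r := by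
  rw [rotated, flipLeft, rotated, above_left (by omega) hj, above_symm]
  by_cases h1 : r = i
  · subst h1
    simp only [true_or, ne_eq, not_true, false_and, or_false, true_iff]
    omega
  by_cases h2 : r = j
  · subst h2
    simp only [h1, ne_eq, not_true, false_and, or_false, true_or, imp_false, false_iff, not_not]
    exact hj
  · simp only [h1, h2, false_or, ne_eq, not_false_eq_true, true_and]
    refine forall_congr' fun hr => ?_
    rw [iff_comm, not_or, not_and]
    constructor
    · exact fun h => h.2 (by omega)
    · exact fun h => ⟨by omega, fun _ => h⟩

theorem rotated_right {s i j : ℕ} (hij : i < j) (hi : 2 ^ s ≤ i) (hj : j ≤ 2 * 2 ^ s) {r : ℕ}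
    (hr' : r ≤ 2 * 2 ^ s) :
    rotated (s + 1) i j r ↔ flipRight s (rotated s (2 * 2 ^ s - j) (2 * 2 ^ s - i)) r := by
  rw [rotated, flipRight, rotated, above_right hi (by omega) (by omega), above_symm]
  by_cases h1 : r = i
  · subst h1
    simp only [true_or, ne_eq, not_true, false_and, or_false, true_iff]
    omega
  by_cases h2 : r = j
  · subst h2
    simp only [h1, ne_eq, not_true, false_and, or_false, true_or, imp_false, false_iff, not_not]
    omega
  · simp only [h1, h2, false_or, ne_eq, not_false_eq_true, true_and]
    refine forall_congr' fun hr => ?_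
    rw [iff_comm, not_or, not_and]
    constructor
    · exact fun h => h.2 (by omega)
    · exact fun h => ⟨by omega, fun _ => h⟩

theorem rotated_mixed {s i j : ℕ} (hi : i < 2 ^ s) (hj : 2 ^ s < j) (r : ℕ) :
    rotated (s + 1) i j r ↔ r ≤ i ∨ j < r := by
  rw [rotated, above_mixed hi hj]
  omega

theorem isVertex_mixed {s p q : ℕ} {U : ℕ → Prop} (hp : p < 2 ^ s) (hq : 2 ^ s < q)
    (hq' : q ≤ 2 * 2 ^ s) (hU : ∀ r, r ≠ p → r ≠ q → (U r ↔ r < p ∨ q < r)) :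
    IsVertex (s + 1) U p q := by
  have := two_pow_succ' s
  refine ⟨by omega, by omega, by omega, fun r hr h1 h2 => ?_⟩
  rw [above_mixed hp hq, hU r h1 h2]
  omega

/-- Two new vertices with a point `c` close a half face. -/
theorem IsHalfFace.insert {s k c : ℕ} {U : ℕ → Prop} {T : Finset ℕ} (h : IsHalfFace s U k T)
    (hc : c ∉ T) (h1 : IsVertex s U k c) (h2 : IsVertex s U (k + 1) c) :
    IsBoundedFace s U (insert c T) := by
  obtain ⟨hk, hk', ⟨q1, hq1, hv1⟩, ⟨q2, hq2, hv2⟩, h⟩ := h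
  refine ⟨⟨c, by simp⟩, fun p hp => ?_⟩
  by_cases e : p = k
  · subst e
    exact ⟨q1, by simp [hq1], c, by simp, fun e => hc (e ▸ hq1), hv1, h1⟩
  by_cases e' : p = k + 1
  · subst e'
    exact ⟨q2, by simp [hq2], c, by simp, fun e => hc (e ▸ hq2), hv2, h2⟩
  rcases Finset.mem_insert.1 hp with rfl | hp
  · exact ⟨k, by simp [hk], k + 1, by simp [hk'], by simp, h1.symm, h2.symm⟩
  · exact (h p hp e e').mono (Finset.subset_insert _ _) fun _ _ => Iff.rfl

/-- For a straddling pair all four vertices are lines between the copies, unless `j + 1` does not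
exist (then the face is unbounded) or `i + 1` is the middle point (then an end of a gap of the right
copy is closed by `i`). For a pair inside a copy the face comes from the copy. The gaps of the left
copy become bounded, since the right copy blocks the steep lines; those of the right copy stay
unbounded. -/
theorem shape_spec {s i j : ℕ} (hij : i < j) (hj : j ≤ 2 ^ s) :
    (∀ e, shape s i j = .inl e → ∃ T, IsBoundedFace s (rotated s i j) T ∧ T.card = e) ∧
    (∀ k, shape s i j = .inr k → k < 2 ^ s ∧ ∀ r ≤ 2 ^ s, (rotated s i j r ↔ r ≤ k)) := by
  induction s generalizing i j with
  | zero =>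
    obtain rfl : j = 1 := by simp at hj; omega
    obtain rfl : i = 0 := by omega
    refine ⟨by simp [shape], ?_⟩
    intro k hk
    obtain rfl : 0 = k := by simpa [shape] using hk
    refine ⟨by simp, fun r hr => ?_⟩
    simp at hr
    simp [rotated]
    omega
  | succ s ih =>
    have hm := Nat.two_pow_pos s
    have e := two_pow_succ' s
    simp only [shape]
    by_cases hmix : i < 2 ^ s ∧ 2 ^ s < j
    · rw [if_pos hmix]
      obtain ⟨hi, hmj⟩ := hmix
      have hrot := fun r => @rotated_mixed s i j hi hmj r
      have hv : ∀ p q, p < 2 ^ s → 2 ^ s < q → q ≤ 2 * 2 ^ s → (p = i ∨ p = i + 1) →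
          (q = j ∨ q = j + 1) → IsVertex (s + 1) (rotated (s + 1) i j) p q := by
        intro p q hp hq hq' h1 h2
        refine isVertex_mixed hp hq hq' fun r h3 h4 => ?_
        rw [hrot]
        omega
      by_cases hj2 : j = 2 * 2 ^ s
      · rw [if_pos hj2]
        refine ⟨by simp, fun k hk => ?_⟩
        obtain rfl : i = k := by simpa using hk
        refine ⟨by omega, fun r hr => ?_⟩
        rw [hrot]
        omega
      rw [if_neg hj2]
      by_cases hi1 : i + 1 < 2 ^ s
      · rw [if_pos hi1]
        refine ⟨fun e he => ?_, by simp⟩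
        obtain rfl : 4 = e := by simpa using he
        have v00 := hv i j (by omega) (by omega) (by omega) (by omega) (by omega)
        have v01 := hv i (j + 1) (by omega) (by omega) (by omega) (by omega) (by omega)
        have v10 := hv (i + 1) j (by omega) (by omega) (by omega) (by omega) (by omega)
        have v11 := hv (i + 1) (j + 1) (by omega) (by omega) (by omega) (by omega) (by omega)
        refine ⟨{i, i + 1, j, j + 1}, ⟨by simp, fun p hp => ?_⟩, ?_⟩
        · simp only [Finset.mem_insert, Finset.mem_singleton] at hp
          rcases hp with rfl | rfl | rfl | rfl
          · exact ⟨j, by simp, j + 1, by simp, by simp, v00, v01⟩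
          · exact ⟨j, by simp, j + 1, by simp, by simp, v10, v11⟩
          · exact ⟨i, by simp, i + 1, by simp, by simp, v00.symm, v10.symm⟩
          · exact ⟨i, by simp, i + 1, by simp, by simp, v01.symm, v11.symm⟩
        · rw [Finset.card_insert_of_notMem, Finset.card_insert_of_notMem,
            Finset.card_insert_of_notMem, Finset.card_singleton]
          all_goals simp; try omega
      · rw [if_neg hi1]
        refine ⟨fun e he => ?_, by simp⟩
        obtain rfl : halfCard s (j - 2 ^ s) + 1 = e := by simpa using he
        -- Here `i + 1` is the middle point. The gap between `j` and `j + 1` has index `2 * 2 ^ s -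
        -- 1 - j` in the reversed right copy.
        obtain ⟨T, hT, hc, -⟩ := @exists_leftHalfFace s (2 * 2 ^ s - 1 - j) (by omega)
        have hle := fun p hp => @IsHalfFace.le _ _ T _ hT p hp
        have hB : IsHalfFace (s + 1) (rotated (s + 1) i j) j (T.image (2 * 2 ^ s - ·)) := by
          refine hT.map _ (fun p q h => h.right.congr fun r hr => ?_) (fun p q hp hq h => ?_) ?_ ?_
          · rw [hrot]; simp only [flipRight]; omega
          · have : 2 * 2 ^ s - p = 2 * 2 ^ s - q := h
            omega
          · omega
          · omega
        have hi' : i ∉ T.image (2 * 2 ^ s - ·) := by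
          intro hx
          obtain ⟨y, hy, hy'⟩ := Finset.mem_image.1 hx
          have := hle y hy
          omega
        refine ⟨_, hB.insert hi' (hv _ _ hi hmj (by omega) (.inl rfl) (.inl rfl)).symm
          (hv _ _ hi (by omega) (by omega) (.inl rfl) (.inr rfl)).symm, ?_⟩
        rw [Finset.card_insert_of_notMem hi', card_image_sub hle (by omega), hc]
        congr 2
        omega
    · rw [if_neg hmix]
      by_cases hj2 : j ≤ 2 ^ s
      · rw [if_pos hj2]
        obtain ⟨ih1, ih2⟩ := @ih (2 ^ s - j) (2 ^ s - i) (by omega) (by omega)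
        have hrot := fun r => @rotated_left s i j hij hj2 r
        have hinj : ∀ p q, p ≤ 2 ^ s → q ≤ 2 ^ s → 2 ^ s - p = 2 ^ s - q → p = q := by
          intros; omega
        cases h : shape s (2 ^ s - j) (2 ^ s - i) with
        | inl e =>
          refine ⟨fun e' he => ?_, by simp⟩
          obtain rfl : e = e' := by simpa using he
          obtain ⟨T, hT, hc⟩ := ih1 e h
          refine ⟨T.image (2 ^ s - ·), hT.map _ (fun p q h => h.left.congr fun r _ => hrot r) hinj,
            ?_⟩
          rw [card_image_sub (fun p hp => (hT.2 p hp).le) le_rfl, hc]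
        | inr k =>
          refine ⟨fun e' he => ?_, by simp⟩
          obtain ⟨hk, hkU⟩ := ih2 k h
          have hrot : ∀ r, rotated (s + 1) i j r ↔ (r ≤ 2 ^ s → r + k < 2 ^ s) := by
            intro r
            rw [hrot, flipLeft]
            refine forall_congr' fun hr => ?_
            rw [hkU _ (by omega)]
            omega
          obtain ⟨T, hT, hc, hT'⟩ := exists_halfFace hk
          have hle := fun p hp => @IsHalfFace.le _ _ T _ hT p hp
          have hA : IsHalfFace (s + 1) (rotated (s + 1) i j) (2 ^ s - k - 1)
              (T.image (2 ^ s - ·)) := by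
            refine hT.map _ (fun p q h => h.left.congr fun r hr => ?_) hinj ?_ ?_
            · rw [hrot]; simp only [flipLeft]; omega
            · omega
            · omega
          have hAle : ∀ x ∈ T.image (2 ^ s - ·), x ≤ 2 ^ s := by
            intro x hx
            obtain ⟨y, hy, rfl⟩ := Finset.mem_image.1 hx
            omega
          have hv : ∀ p, p < 2 ^ s → (p = 2 ^ s - k - 1 ∨ p = 2 ^ s - k - 1 + 1) →
              IsVertex (s + 1) (rotated (s + 1) i j) p (2 ^ s + 1) := by
            intro p hp h1
            refine isVertex_mixed hp (by omega) (by omega) fun r h3 h4 => ?_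
            rw [hrot]
            omega
          -- For `k = 0` the gap ends at the common point `2 ^ s`, and the pair `2 ^ s`, `2 ^ s + 1`
          -- belongs to the right copy. The path there from `2 ^ s` to `2 ^ s + 1` is an end of a
          -- gap of that copy. The two ends share only `2 ^ s`, and the vertex of `2 ^ s - 1` and `2
          -- ^ s + 1` closes the cycle; hence the edge count `2 * halfCard s 0 - 1`.
          by_cases hk0 : k = 0
          · subst hk0
            obtain rfl : 2 * halfCard s 0 - 1 = e' := by simpa using he
            obtain ⟨T2, hT2, hc2, -⟩ := @exists_leftHalfFace s (2 ^ s - 1) (by omega)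
            have hle2 := fun p hp => @IsHalfFace.le _ _ T2 _ hT2 p hp
            have hB : IsHalfFace (s + 1) (rotated (s + 1) i j) (2 ^ s)
                (T2.image (2 * 2 ^ s - ·)) := by
              refine hT2.map _ (fun p q h => h.right.congr fun r hr => ?_) (fun p q hp hq h => ?_)
                ?_ ?_
              · rw [hrot]; simp only [flipRight]; omega
              · have : 2 * 2 ^ s - p = 2 * 2 ^ s - q := h
                omega
              · omega
              · omega
            have hBle : ∀ x ∈ T2.image (2 * 2 ^ s - ·), 2 ^ s ≤ x := by
              intro x hx
              obtain ⟨y, hy, rfl⟩ := Finset.mem_image.1 hx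
              have := hle2 y hy
              omega
            have ek : 2 ^ s - 0 - 1 + 1 = 2 ^ s := by omega
            have v := hv (2 ^ s - 0 - 1) (by omega) (.inl rfl)
            have hcap : T.image (2 ^ s - ·) ∩ T2.image (2 * 2 ^ s - ·) = {2 ^ s} := by
              refine Finset.Subset.antisymm (fun x hx => ?_) ?_
              · rw [Finset.mem_inter] at hx
                have := hAle x hx.1
                have := hBle x hx.2
                simp
                omega
              · have := hA.2.1
                rw [ek] at this
                simpa only [Finset.singleton_subset_iff, Finset.mem_inter] using ⟨this, hB.1⟩
            obtain ⟨a1, a2, ⟨qa, hqa, va⟩, ⟨qa', hqa', va'⟩, hA⟩ := hA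
            obtain ⟨b1, b2, ⟨qb, hqb, vb⟩, ⟨qb', hqb', vb'⟩, hB⟩ := hB
            rw [ek] at a2 va'
            refine ⟨T.image (2 ^ s - ·) ∪ T2.image (2 * 2 ^ s - ·), ⟨⟨_, Finset.mem_union_left _ a1⟩,
              fun p hp => ?_⟩, ?_⟩
            · by_cases p1 : p = 2 ^ s - 0 - 1
              · subst p1
                refine ⟨qa, Finset.mem_union_left _ hqa, _, Finset.mem_union_right _ b2, ?_, va, v⟩
                have := hAle _ hqa
                omega
              by_cases p2 : p = 2 ^ s
              · subst p2
                refine ⟨qa', Finset.mem_union_left _ hqa', qb, Finset.mem_union_right _ hqb, ?_,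
                  va', vb⟩
                have := hAle _ hqa'
                have := hBle _ hqb
                have := va'.2.2.1
                omega
              by_cases p3 : p = 2 ^ s + 1
              · subst p3
                refine ⟨_, Finset.mem_union_left _ a1, qb', Finset.mem_union_right _ hqb', ?_,
                  v.symm, vb'⟩
                have := hBle _ hqb'
                omega
              rcases Finset.mem_union.1 hp with hp | hp
              · exact (hA p hp p1 (by omega)).mono Finset.subset_union_left fun _ _ => Iff.rfl
              · exact (hB p hp p2 p3).mono Finset.subset_union_right fun _ _ => Iff.rfl
            · have := Finset.card_union_add_card_inter (T.image (2 ^ s - ·))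
                (T2.image (2 * 2 ^ s - ·))
              rw [hcap, Finset.card_singleton, card_image_sub hle le_rfl,
                card_image_sub hle2 (by omega), hc, hc2, Nat.sub_self] at this
              omega
          -- Away from the middle point, the first point `2 ^ s + 1` of the right copy after the
          -- middle forms vertices with both points of the gap and closes the cycle alone.
          · obtain rfl : halfCard s k + 1 = e' := by simpa [hk0] using he
            have hn : 2 ^ s + 1 ∉ T.image (2 ^ s - ·) := fun hx => by
              have := hAle _ hx
              omega
            refine ⟨_, hA.insert hn (hv _ (by omega) (.inl rfl)) (hv _ (by omega) (.inr rfl)), ?_⟩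
            rw [Finset.card_insert_of_notMem hn, card_image_sub hle le_rfl, hc]
      · rw [if_neg hj2]
        obtain ⟨ih1, ih2⟩ := @ih (2 * 2 ^ s - j) (2 * 2 ^ s - i) (by omega) (by omega)
        have hrot := fun r hr => @rotated_right s i j hij (by omega) (by omega) r hr
        cases h : shape s (2 * 2 ^ s - j) (2 * 2 ^ s - i) with
        | inl e =>
          refine ⟨fun e' he => ?_, by simp⟩
          obtain rfl : e = e' := by simpa using he
          obtain ⟨T, hT, hc⟩ := ih1 e h
          refine ⟨T.image (2 * 2 ^ s - ·), hT.map _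
            (fun p q h => h.right.congr fun r hr => hrot r (by omega)) ?_, ?_⟩
          · intro p q hp hq h
            have : 2 * 2 ^ s - p = 2 * 2 ^ s - q := h
            omega
          · rw [card_image_sub (fun p hp => (hT.2 p hp).le) (by omega), hc]
        | inr k =>
          refine ⟨by simp, fun k' hk' => ?_⟩
          obtain ⟨hk, hkU⟩ := ih2 k h
          obtain rfl : 2 * 2 ^ s - 1 - k = k' := by simpa using hk'
          refine ⟨by omega, fun r hr => ?_⟩
          rw [hrot r (by omega), flipRight]
          by_cases hr' : 2 ^ s ≤ r
          · rw [hkU _ (by omega)]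
            omega
          · simp only [hr', false_imp_iff, true_iff]
            omega

/-- The points of `T` form a closed cycle of vertices of the face `U`. -/
def IsFaceCycle (s : ℕ) (U : ℕ → Prop) (T : Finset ℕ) : Prop :=
  T.Nonempty ∧ ∀ p ∈ T, ∃ q ∈ T, ∃ q' ∈ T, q ≠ q' ∧
    (IsVertex s U p q ∨ IsVertex s (fun r => ¬ U r) p q) ∧
    (IsVertex s U p q' ∨ IsVertex s (fun r => ¬ U r) p q')

/-- The number of edges of the face `rotated s i j`. -/
def edgeCount (s i j : ℕ) : ℕ :=
  (shape s i j).elim id fun k => halfCard s k + halfCard s (2 ^ s - 1 - k) - 2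

/-- With `q = q'` a third point would have to be both above and not above the line `pq`. A third
point exists because `s ≠ 0`. -/
theorem IsVertex.ne_of_compl {s p q q' : ℕ} {U : ℕ → Prop} (hs : s ≠ 0) (h : IsVertex s U p q)
    (h' : IsVertex s (fun r => ¬ U r) p q') : q ≠ q' := by
  rintro rfl
  obtain ⟨s, rfl⟩ := Nat.exists_eq_succ_of_ne_zero hs
  have := Nat.two_pow_pos s
  have e := two_pow_succ' s
  obtain ⟨r, hr, h1, h2⟩ : ∃ r ≤ 2, r ≠ p ∧ r ≠ q := by
    by_cases h0 : 0 ≠ p ∧ 0 ≠ q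
    · exact ⟨0, by simp, h0⟩
    by_cases h0 : 1 ≠ p ∧ 1 ≠ q
    · exact ⟨1, by simp, h0⟩
    · exact ⟨2, by simp, by omega⟩
  have h3 := h.2.2.2 r (by omega) h1 h2
  have h4 := h'.2.2.2 r (by omega) h1 h2
  tauto

theorem exists_faceCycle {s i j : ℕ} (hs : s ≠ 0) (hij : i < j) (hj : j ≤ 2 ^ s) :
    ∃ T, IsFaceCycle s (rotated s i j) T ∧ T.card = edgeCount s i j := by
  obtain ⟨h1, h2⟩ := shape_spec hij hj
  cases h : shape s i j with
  | inl e =>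
    obtain ⟨T, hT, hc⟩ := h1 e h
    refine ⟨T, ⟨hT.1, fun p hp => ?_⟩, by simp [edgeCount, h, hc]⟩
    obtain ⟨q, hq, q', hq', hne, v, v'⟩ := hT.2 p hp
    exact ⟨q, hq, q', hq', hne, .inl v, .inl v'⟩
  | inr k =>
    obtain ⟨hk, hU⟩ := h2 k h
    obtain ⟨T, hT, hc, h3, h4⟩ := exists_halfFace hk
    obtain ⟨T', hT', hc', h3', h4'⟩ := exists_leftHalfFace hk
    replace hT : IsHalfFace s (rotated s i j) k T := hT.congr hU
    replace hT' : IsHalfFace s (fun r => ¬ rotated s i j r) k T' := hT'.congr fun r hr => by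
      rw [hU r hr]; omega
    -- One of the two paths stays in the half of the chain that contains the gap, and the other one
    -- has only `k` and `k + 1` in this half.
    have hcap : T ∩ T' = {k, k + 1} := by
      refine Finset.Subset.antisymm (fun x hx => ?_) (fun x hx => ?_)
      · rw [Finset.mem_inter] at hx
        obtain ⟨s, rfl⟩ := Nat.exists_eq_succ_of_ne_zero hs
        have e := two_pow_succ' s
        simp only [Finset.mem_insert, Finset.mem_singleton]
        rcases lt_or_ge k (2 ^ s) with hlt | hge
        · exact h3 (by simp only [Nat.succ_eq_add_one]; omega) x hx.1
            (h4' (by simp only [Nat.succ_eq_add_one]; omega) x hx.2)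
        · exact h3' (by simp only [Nat.succ_eq_add_one]; omega) x hx.2
            (h4 (by simp only [Nat.succ_eq_add_one]; omega) x hx.1)
      · simp only [Finset.mem_insert, Finset.mem_singleton] at hx
        rcases hx with rfl | rfl
        · exact Finset.mem_inter.2 ⟨hT.1, hT'.1⟩
        · exact Finset.mem_inter.2 ⟨hT.2.1, hT'.2.1⟩
    obtain ⟨a1, a2, ⟨qa, hqa, va⟩, ⟨qa', hqa', va'⟩, hA⟩ := hT
    obtain ⟨b1, b2, ⟨qb, hqb, vb⟩, ⟨qb', hqb', vb'⟩, hB⟩ := hT'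
    refine ⟨T ∪ T', ⟨⟨k, Finset.mem_union_left _ a1⟩, fun p hp => ?_⟩, ?_⟩
    · by_cases p1 : p = k
      · subst p1
        exact ⟨qa, Finset.mem_union_left _ hqa, qb, Finset.mem_union_right _ hqb,
          va.ne_of_compl hs vb, .inl va, .inr vb⟩
      by_cases p2 : p = k + 1
      · subst p2
        exact ⟨qa', Finset.mem_union_left _ hqa', qb', Finset.mem_union_right _ hqb',
          va'.ne_of_compl hs vb', .inl va', .inr vb'⟩
      rcases Finset.mem_union.1 hp with hp | hp
      · obtain ⟨q, hq, q', hq', hne, v, v'⟩ := hA p hp p1 p2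
        exact ⟨q, Finset.mem_union_left _ hq, q', Finset.mem_union_left _ hq', hne, .inl v, .inl v'⟩
      · obtain ⟨q, hq, q', hq', hne, v, v'⟩ := hB p hp p1 p2
        exact ⟨q, Finset.mem_union_right _ hq, q', Finset.mem_union_right _ hq', hne,
          .inr v, .inr v'⟩
    · have := Finset.card_union_add_card_inter T T'
      rw [hcap, Finset.card_pair (by simp), hc, hc'] at this
      simp only [edgeCount, h, Sum.elim_inr]
      omega

/-- The lines that miss the convex hull form a single projective face, with one edge for each vertex
of the hull. The hull is the initial triangle. Its top side has all other points below it, so this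
vertex belongs to the complementary sign vector. -/
theorem isFaceCycle_true (s : ℕ) :
    IsFaceCycle (s + 1) (fun _ => True) {0, 2 ^ s, 2 * 2 ^ s} := by
  have hm := Nat.two_pow_pos s
  have e := two_pow_succ' s
  have v1 : IsVertex (s + 1) (fun _ => True) 0 (2 ^ s) :=
    ⟨by omega, by omega, by omega, fun r hr h1 h2 => by simp [above_left_ends h1 h2]⟩
  have v2 : IsVertex (s + 1) (fun _ => True) (2 ^ s) (2 * 2 ^ s) :=
    ⟨by omega, by omega, by omega, fun r hr h1 h2 => by
      simpa only [true_iff] using above_right_ends (by omega) h2 h1⟩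
  have v3 : IsVertex (s + 1) (fun _ => ¬ True) 0 (2 * 2 ^ s) :=
    ⟨by omega, by omega, by omega, fun r hr h1 h2 => by
      rw [above_mixed (by omega) (by omega)]; simp; omega⟩
  refine ⟨by simp, fun p hp => ?_⟩
  simp only [Finset.mem_insert, Finset.mem_singleton] at hp
  rcases hp with rfl | rfl | rfl
  · exact ⟨2 ^ s, by simp, 2 * 2 ^ s, by simp, by omega, .inl v1, .inr v3⟩
  · exact ⟨0, by simp, 2 * 2 ^ s, by simp, by omega, .inl v1.symm, .inl v2⟩
  · exact ⟨2 ^ s, by simp, 0, by simp, by omega, .inl v2.symm, .inr v3.symm⟩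

/-! ### Counting the pentagons -/

theorem halfCard_bounds (s k : ℕ) : 2 ≤ halfCard s k ∧ halfCard s k ≤ 4 := by
  induction s generalizing k with
  | zero => simp [halfCard]
  | succ s ih =>
    simp only [halfCard]
    split_ifs <;> first | omega | exact ih _

theorem halfCard_zero (s : ℕ) : halfCard (s + 1) 0 = 3 := by
  cases s with
  | zero => simp [halfCard]
  | succ s =>
    have := Nat.one_lt_two_pow (Nat.succ_ne_zero s)
    simp only [halfCard]
    rw [if_pos (by omega)]

theorem halfCard_reflect {s k : ℕ} (hk : k < 2 ^ s) :
    halfCard (s + 1) (2 * 2 ^ s - 1 - k) = halfCard s k := by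
  rw [halfCard, if_neg (by omega), if_neg (by omega), Nat.sub_sub_self (by omega)]

/-- The corresponding value for `K_1` is 2. Through the reflection this leaves the two middle gaps
of `K_2` with four edges instead of five, which is why the formula fails for `s = 2`. -/
theorem halfCard_last (s : ℕ) : halfCard (s + 2) (2 ^ (s + 2) - 1) = 3 := by
  have e := two_pow_succ' (s + 1)
  have := halfCard_reflect (Nat.two_pow_pos (s + 1))
  rw [halfCard_zero, Nat.sub_zero, ← e] at this
  exact this

theorem shape_inl_bounds {s i j e : ℕ} (h : shape s i j = .inl e) : 3 ≤ e ∧ e ≤ 5 := by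
  induction s generalizing i j with
  | zero => simp [shape] at h
  | succ s ih =>
    simp only [shape] at h
    split_ifs at h with h1 h2 h3 h4
    · obtain rfl := Sum.inl.inj h
      simp
    · obtain rfl := Sum.inl.inj h
      have := halfCard_bounds s (j - 2 ^ s)
      omega
    · cases h' : shape s (2 ^ s - j) (2 ^ s - i) with
      | inl e' =>
        rw [h'] at h
        obtain rfl := Sum.inl.inj h
        exact ih h'
      | inr k =>
        rw [h'] at h
        obtain rfl := Sum.inl.inj h
        have := halfCard_bounds s k
        have h0 : halfCard s 0 ≤ 3 := by
          cases s with
          | zero => simp [halfCard]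
          | succ s => rw [halfCard_zero]
        have := halfCard_bounds s 0
        split_ifs <;> omega
    · cases h' : shape s (2 * 2 ^ s - j) (2 * 2 ^ s - i) with
      | inl e' =>
        rw [h'] at h
        obtain rfl := Sum.inl.inj h
        exact ih h'
      | inr k => simp [h'] at h

theorem edgeCount_bounds {s i j : ℕ} (hs : s ≠ 0) (hij : i < j) (hj : j ≤ 2 ^ s) :
    3 ≤ edgeCount s i j ∧ edgeCount s i j ≤ 5 := by
  rw [edgeCount]
  cases h : shape s i j with
  | inl e => exact shape_inl_bounds h
  | inr k =>
    have hk := ((shape_spec hij hj).2 k h).1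
    rw [Sum.elim_inr]
    obtain ⟨s, rfl⟩ := Nat.exists_eq_succ_of_ne_zero hs
    rw [Nat.succ_eq_add_one, two_pow_succ'] at *
    -- By `halfCard_reflect` these are the numbers of lines at the two ends of a gap in the left
    -- half; the right half follows by symmetry. The lines of `k` and `k + 1` occur at both ends, so
    -- two is subtracted in the edge count.
    have key : ∀ k < 2 ^ s, 5 ≤ halfCard (s + 1) k + halfCard s k ∧
        halfCard (s + 1) k + halfCard s k ≤ 7 := by
      intro k hk
      have := halfCard_bounds s k
      rw [halfCard]
      split_ifs with h1 h2 h3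
      · omega
      · subst h3
        simp [halfCard]
      · match s with
        | 1 =>
          obtain rfl : k = 1 := by simp at h2; omega
          simp [halfCard]
        | s + 2 =>
          obtain rfl : k = 2 ^ (s + 2) - 1 := by omega
          rw [halfCard_last]
          omega
      · omega
    rcases lt_or_ge k (2 ^ s) with hlt | hge
    · rw [halfCard_reflect hlt]
      have := key k hlt
      omega
    · have := key (2 * 2 ^ s - 1 - k) (by omega)
      have e := @halfCard_reflect s (2 * 2 ^ s - 1 - k) (by omega)
      rw [Nat.sub_sub_self (by omega)] at e
      omega

/-- The pairs `i < j` of points of `K_s`. -/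
def pairs (s : ℕ) : Finset (ℕ × ℕ) :=
  (Finset.range (2 ^ s + 1) ×ˢ Finset.range (2 ^ s + 1)).filter fun x => x.1 < x.2

theorem mem_pairs {s : ℕ} {x : ℕ × ℕ} : x ∈ pairs s ↔ x.1 < x.2 ∧ x.2 ≤ 2 ^ s := by
  simp only [pairs, Finset.mem_filter, Finset.mem_product, Finset.mem_range]
  omega

theorem sum_pairs_succ (s : ℕ) (G : ℕ → ℕ → ℕ) :
    ∑ x ∈ pairs (s + 1), G x.1 x.2 =
      ∑ x ∈ pairs s, G (2 ^ s - x.2) (2 ^ s - x.1) +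
      ∑ x ∈ pairs s, G (2 * 2 ^ s - x.2) (2 * 2 ^ s - x.1) +
      ∑ i ∈ Finset.range (2 ^ s), ∑ t ∈ Finset.range (2 ^ s), G i (2 ^ s + 1 + t) := by
  have e := two_pow_succ' s
  rw [← Finset.sum_filter_add_sum_filter_not (pairs (s + 1)) (fun x => x.2 ≤ 2 ^ s),
    ← Finset.sum_filter_add_sum_filter_not ((pairs (s + 1)).filter (fun x => ¬ x.2 ≤ 2 ^ s))
      (fun x => 2 ^ s ≤ x.1), ← add_assoc, ← Finset.sum_product']
  congr 1
  · congr 1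
    · refine Finset.sum_nbij' (fun x => (2 ^ s - x.2, 2 ^ s - x.1))
        (fun x => (2 ^ s - x.2, 2 ^ s - x.1)) ?_ ?_ ?_ ?_ ?_
      all_goals
        rintro ⟨i, j⟩ hx
        simp only [Finset.mem_filter, mem_pairs] at hx ⊢
      · omega
      · omega
      · ext <;> simp <;> omega
      · ext <;> simp <;> omega
      · rw [Nat.sub_sub_self (by omega), Nat.sub_sub_self (by omega)]
    · refine Finset.sum_nbij' (fun x => (2 * 2 ^ s - x.2, 2 * 2 ^ s - x.1))
        (fun x => (2 * 2 ^ s - x.2, 2 * 2 ^ s - x.1)) ?_ ?_ ?_ ?_ ?_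
      all_goals
        rintro ⟨i, j⟩ hx
        simp only [Finset.mem_filter, mem_pairs] at hx ⊢
      · omega
      · omega
      · ext <;> simp <;> omega
      · ext <;> simp <;> omega
      · rw [Nat.sub_sub_self (by omega), Nat.sub_sub_self (by omega)]
  · refine Finset.sum_nbij' (fun x => (x.1, x.2 - (2 ^ s + 1)))
        (fun x => (x.1, 2 ^ s + 1 + x.2)) ?_ ?_ ?_ ?_ ?_
    all_goals
      rintro ⟨i, j⟩ hx
      simp only [Finset.mem_filter, mem_pairs, Finset.mem_product, Finset.mem_range] at hx ⊢
    · omega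
    · omega
    · ext <;> simp; omega
    · simp
    · rw [Nat.add_sub_of_le (by omega)]

theorem shape_left {s i j : ℕ} (h : j ≤ 2 ^ s) :
    shape (s + 1) i j = (shape s (2 ^ s - j) (2 ^ s - i)).elim .inl
      fun k => .inl (if k = 0 then 2 * halfCard s 0 - 1 else halfCard s k + 1) := by
  rw [shape, if_neg (by omega), if_pos h]

theorem shape_right {s i j : ℕ} (hij : i < j) (h : 2 ^ s ≤ i) :
    shape (s + 1) i j = (shape s (2 * 2 ^ s - j) (2 * 2 ^ s - i)).elim .inl
      fun k => .inr (2 * 2 ^ s - 1 - k) := by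
  rw [shape, if_neg (by omega), if_neg (by omega)]

theorem shape_mixed {s i t : ℕ} (hi : i < 2 ^ s) :
    shape (s + 1) i (2 ^ s + 1 + t) = if t = 2 ^ s - 1 then .inr i
      else if i + 1 < 2 ^ s then .inl 4 else .inl (halfCard s (t + 1) + 1) := by
  rw [shape, if_pos (by omega)]
  rw [show 2 ^ s + 1 + t - 2 ^ s = t + 1 by omega]
  refine if_congr ?_ rfl rfl
  omega

theorem sum_shape_succ (s : ℕ) (g : ℕ ⊕ ℕ → ℕ) :
    ∑ x ∈ pairs (s + 1), g (shape (s + 1) x.1 x.2) =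
      ∑ x ∈ pairs s, g ((shape s x.1 x.2).elim .inl
        fun k => .inl (if k = 0 then 2 * halfCard s 0 - 1 else halfCard s k + 1)) +
      ∑ x ∈ pairs s, g ((shape s x.1 x.2).elim .inl fun k => .inr (2 * 2 ^ s - 1 - k)) +
      ∑ i ∈ Finset.range (2 ^ s), ∑ t ∈ Finset.range (2 ^ s), g (if t = 2 ^ s - 1 then .inr i
        else if i + 1 < 2 ^ s then .inl 4 else .inl (halfCard s (t + 1) + 1)) := by
  rw [sum_pairs_succ s (fun i j => g (shape (s + 1) i j))]
  congr 1
  · congr 1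
    · refine Finset.sum_congr rfl fun x hx => ?_
      rw [mem_pairs] at hx
      rw [shape_left (by omega), Nat.sub_sub_self (by omega), Nat.sub_sub_self (by omega)]
    · refine Finset.sum_congr rfl fun x hx => ?_
      rw [mem_pairs] at hx
      rw [shape_right (by omega) (by omega), Nat.sub_sub_self (by omega),
        Nat.sub_sub_self (by omega)]
  · refine Finset.sum_congr rfl fun i hi => Finset.sum_congr rfl fun t _ => ?_
    rw [shape_mixed (Finset.mem_range.1 hi)]

/-- Every gap between consecutive points belongs to exactly one pair. -/
theorem sum_shape_inr (s : ℕ) (g : ℕ → ℕ) :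
    ∑ x ∈ pairs s, (shape s x.1 x.2).elim (fun _ => 0) g = ∑ k ∈ Finset.range (2 ^ s), g k := by
  induction s generalizing g with
  | zero => simp [shape, show pairs 0 = {(0, 1)} from rfl]
  | succ s ih =>
    have hm := Nat.two_pow_pos s
    rw [sum_shape_succ s (fun x => x.elim (fun _ => 0) g)]
    have h1 : ∑ x ∈ pairs s, ((shape s x.1 x.2).elim (Sum.inl (β := ℕ))
        fun k => .inl (if k = 0 then 2 * halfCard s 0 - 1 else halfCard s k + 1)).elim
          (fun _ => 0) g = 0 := by
      refine Finset.sum_eq_zero fun x _ => ?_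
      cases shape s x.1 x.2 <;> rfl
    have h2 : ∑ x ∈ pairs s, ((shape s x.1 x.2).elim Sum.inl
        fun k => .inr (2 * 2 ^ s - 1 - k)).elim (fun _ => 0) g =
        ∑ k ∈ Finset.range (2 ^ s), g (2 ^ s + k) := by
      rw [← Finset.sum_range_reflect, ← ih]
      refine Finset.sum_congr rfl fun x hx => ?_
      rw [mem_pairs] at hx
      cases h : shape s x.1 x.2 with
      | inl e => rfl
      | inr k =>
        have := ((shape_spec hx.1 hx.2).2 k h).1
        simp only [Sum.elim_inr]
        congr 1
        omega
    have h3 : ∑ i ∈ Finset.range (2 ^ s), ∑ t ∈ Finset.range (2 ^ s),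
        (if t = 2 ^ s - 1 then Sum.inr i
        else if i + 1 < 2 ^ s then .inl 4 else .inl (halfCard s (t + 1) + 1)).elim
          (fun _ => 0) g = ∑ k ∈ Finset.range (2 ^ s), g k := by
      refine Finset.sum_congr rfl fun i _ => ?_
      rw [Finset.sum_eq_single (2 ^ s - 1)]
      · simp
      · intro t _ ht
        rw [if_neg ht]
        split_ifs <;> rfl
      · simp
    rw [h1, h2, h3, two_pow_succ', two_mul, Finset.sum_range_add]
    omega

/-- The number of bounded pentagons. -/
def boundedPentagons (s : ℕ) : ℕ :=
  ∑ x ∈ pairs s, (shape s x.1 x.2).elim (fun e => if e = 5 then 1 else 0) fun _ => 0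

/-- The number of gaps whose half faces are bounded by four lines. -/
def fourHalves (s : ℕ) : ℕ := ∑ k ∈ Finset.range (2 ^ s), if halfCard s k = 4 then 1 else 0

/-- Both copies pass on their bounded pentagons. Closing the gaps of the left copy gives a pentagon
for each end with four lines, and one at gap 0 since `2 * 3 - 1 = 5`. The pairs with `i` just left
of the middle point close the opposite ends of the gaps of the right copy, again with one pentagon
for each end with four lines. -/
theorem boundedPentagons_succ (s : ℕ) :
    boundedPentagons (s + 2) = 2 * boundedPentagons (s + 1) + 1 + 2 * fourHalves (s + 1) := by
  obtain ⟨m, hm⟩ : ∃ m, 2 ^ (s + 1) = m + 1 :=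
    ⟨2 ^ (s + 1) - 1, by have := Nat.two_pow_pos (s + 1); omega⟩
  have hc : fourHalves (s + 1) =
      ∑ k ∈ Finset.range m, if halfCard (s + 1) (k + 1) = 4 then 1 else 0 := by
    rw [fourHalves, hm, Finset.sum_range_succ', halfCard_zero]
    rfl
  rw [boundedPentagons, sum_shape_succ (s + 1)
    (fun x => x.elim (fun e => if e = 5 then 1 else 0) fun _ => 0)]
  have h1 : ∑ x ∈ pairs (s + 1), ((shape (s + 1) x.1 x.2).elim (Sum.inl (β := ℕ))
      fun k => .inl (if k = 0 then 2 * halfCard (s + 1) 0 - 1 else halfCard (s + 1) k + 1)).elim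
        (fun e => if e = 5 then 1 else 0) (fun _ => 0) =
      boundedPentagons (s + 1) + (fourHalves (s + 1) + 1) := by
    have : fourHalves (s + 1) + 1 = ∑ k ∈ Finset.range (2 ^ (s + 1)),
        if (if k = 0 then 2 * halfCard (s + 1) 0 - 1 else halfCard (s + 1) k + 1) = 5
          then 1 else 0 := by
      rw [hc, hm, Finset.sum_range_succ', halfCard_zero]
      simp
    rw [this, ← sum_shape_inr, boundedPentagons, ← Finset.sum_add_distrib]
    refine Finset.sum_congr rfl fun x _ => ?_
    cases shape (s + 1) x.1 x.2 <;> simp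
  have h2 : ∑ x ∈ pairs (s + 1), ((shape (s + 1) x.1 x.2).elim Sum.inl
      fun k => .inr (2 * 2 ^ (s + 1) - 1 - k)).elim
        (fun e => if e = 5 then 1 else 0) (fun _ => 0) = boundedPentagons (s + 1) := by
    refine Finset.sum_congr rfl fun x _ => ?_
    cases shape (s + 1) x.1 x.2 <;> simp
  have h3 : ∑ i ∈ Finset.range (2 ^ (s + 1)), ∑ t ∈ Finset.range (2 ^ (s + 1)),
      (if t = 2 ^ (s + 1) - 1 then Sum.inr i
      else if i + 1 < 2 ^ (s + 1) then .inl 4 else .inl (halfCard (s + 1) (t + 1) + 1)).elim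
        (fun e => if e = 5 then 1 else 0) (fun _ => 0) = fourHalves (s + 1) := by
    rw [Finset.sum_eq_single m, hm, Finset.sum_range_succ, hc]
    · simp only [Nat.add_sub_cancel, lt_irrefl, if_true, if_false, Sum.elim_inr, add_zero]
      refine Finset.sum_congr rfl fun t ht => ?_
      rw [Finset.mem_range] at ht
      rw [if_neg (by omega)]
      simp
    · intro i hi hne
      refine Finset.sum_eq_zero fun t _ => ?_
      rw [Finset.mem_range] at hi
      split_ifs
      · rfl
      · rfl
      · omega
    · simp [hm]
  rw [h1, h2, h3]
  omega

/-- Each level after the first adds the gap that ends at the middle point; the gaps of the right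
copy keep their numbers, and the other gaps of the left copy have three lines. -/
theorem fourHalves_eq (s : ℕ) : fourHalves (s + 1) = s := by
  induction s with
  | zero => rfl
  | succ s ih =>
    obtain ⟨m, hm⟩ : ∃ m, 2 ^ (s + 1) = m + 1 :=
      ⟨2 ^ (s + 1) - 1, by have := Nat.two_pow_pos (s + 1); omega⟩
    rw [fourHalves, two_pow_succ', two_mul, Finset.sum_range_add]
    have h1 : ∑ k ∈ Finset.range (2 ^ (s + 1)), (if halfCard (s + 2) k = 4 then 1 else 0) = 1 := by
      rw [hm, Finset.sum_range_succ, Finset.sum_eq_zero]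
      · simp [halfCard, hm]
      · intro k hk
        rw [Finset.mem_range] at hk
        simp [halfCard, show k + 1 < 2 ^ (s + 1) by omega]
    have h2 : ∑ k ∈ Finset.range (2 ^ (s + 1)),
        (if halfCard (s + 2) (2 ^ (s + 1) + k) = 4 then 1 else 0) = s := by
      refine Eq.trans ?_ ih
      rw [fourHalves, ← Finset.sum_range_reflect]
      refine Finset.sum_congr rfl fun k hk => ?_
      rw [Finset.mem_range] at hk
      rw [← halfCard_reflect hk, show 2 * 2 ^ (s + 1) - 1 - k =
        2 ^ (s + 1) + (2 ^ (s + 1) - 1 - k) by omega]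
    rw [h1, h2, add_comm]

theorem boundedPentagons_eq (s : ℕ) : boundedPentagons (s + 2) + 2 * s + 5 = 6 * 2 ^ s := by
  induction s with
  | zero => rfl
  | succ s ih =>
    have h := boundedPentagons_succ (s + 1)
    rw [fourHalves_eq] at h
    rw [two_pow_succ', h]
    change boundedPentagons (s + 1 + 1) + _ + _ = _ at ih
    omega

/-- The number of unbounded pentagons. -/
theorem sum_gaps (s : ℕ) : ∑ k ∈ Finset.range (2 ^ (s + 3)),
    (if halfCard (s + 3) k + halfCard (s + 3) (2 ^ (s + 3) - 1 - k) - 2 = 5 then 1 else 0) =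
      2 * s + 4 := by
  obtain ⟨m, hm⟩ : ∃ m, 2 ^ (s + 2) = m + 1 :=
    ⟨2 ^ (s + 2) - 1, by have := Nat.two_pow_pos (s + 2); omega⟩
  have hlast := halfCard_last s
  rw [hm, Nat.add_sub_cancel] at hlast
  -- In the left half all gaps but the last have three lines at the right end, so they give five
  -- edges exactly when the other end has four; this happens `s + 1` times. The last one gives `4 +
  -- 3 - 2 = 5`.
  have h1 : ∑ k ∈ Finset.range (2 ^ (s + 2)),
      (if halfCard (s + 3) k + halfCard (s + 3) (2 * 2 ^ (s + 2) - 1 - k) - 2 = 5 then 1 else 0) =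
      s + 2 := by
    have h4 : fourHalves (s + 2) = s + 1 := fourHalves_eq (s + 1)
    rw [fourHalves, hm, Finset.sum_range_succ, hlast] at h4
    rw [hm, Finset.sum_range_succ, ← hm, halfCard_reflect (by omega), hlast]
    have h5 : halfCard (s + 3) m = 4 := by simp [halfCard, hm]
    rw [h5, if_pos rfl]
    refine Eq.trans ?_ (congrArg (· + 1) h4)
    rw [if_neg (by norm_num), add_zero]
    congr 1
    refine Finset.sum_congr rfl fun k hk => ?_
    rw [Finset.mem_range] at hk
    rw [halfCard_reflect (by omega)]
    have h6 : halfCard (s + 3) k = 3 := by simp [halfCard, show k + 1 < 2 ^ (s + 2) by omega]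
    rw [h6]
    refine if_congr ?_ rfl rfl
    omega
  rw [two_pow_succ', two_mul, Finset.sum_range_add, ← two_mul, h1]
  have h2 : ∑ k ∈ Finset.range (2 ^ (s + 2)), (if halfCard (s + 3) (2 ^ (s + 2) + k) +
      halfCard (s + 3) (2 * 2 ^ (s + 2) - 1 - (2 ^ (s + 2) + k)) - 2 = 5 then 1 else 0) =
      s + 2 := by
    refine Eq.trans ?_ h1
    rw [← Finset.sum_range_reflect]
    refine Finset.sum_congr rfl fun k hk => ?_
    rw [Finset.mem_range] at hk
    rw [add_comm (halfCard _ _), show 2 ^ (s + 2) + (2 ^ (s + 2) - 1 - k) =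
      2 * 2 ^ (s + 2) - 1 - k by omega, Nat.sub_sub_self (by omega)]
  rw [h2]
  omega

theorem sum_pentagons (s : ℕ) : ((pairs s).filter fun x => edgeCount s x.1 x.2 = 5).card =
    boundedPentagons s + ∑ k ∈ Finset.range (2 ^ s),
      if halfCard s k + halfCard s (2 ^ s - 1 - k) - 2 = 5 then 1 else 0 := by
  rw [Finset.card_filter, ← sum_shape_inr, boundedPentagons, ← Finset.sum_add_distrib]
  refine Finset.sum_congr rfl fun x _ => ?_
  rw [edgeCount]
  cases shape s x.1 x.2 <;> simp <;> rfl

theorem card_pentagon_pairs {s : ℕ} (hs : 3 ≤ s) :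
    ((pairs s).filter fun x => edgeCount s x.1 x.2 = 5).card = 3 * 2 ^ (s - 1) - 3 := by
  obtain ⟨s, rfl⟩ := Nat.exists_eq_add_of_le' hs
  rw [sum_pentagons, sum_gaps]
  have : boundedPentagons (s + 3) + _ + _ = _ := boundedPentagons_eq (s + 1)
  rw [two_pow_succ'] at this
  rw [show s + 3 - 1 = s + 1 + 1 by omega, two_pow_succ', two_pow_succ']
  omega

theorem card_pentagon_pairs_one :
    ((pairs 1).filter fun x => edgeCount 1 x.1 x.2 = 5).card = 0 := by
  decide

theorem card_pentagon_pairs_two :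
    ((pairs 2).filter fun x => edgeCount 2 x.1 x.2 = 5).card = 1 := by
  decide

/-! ### Cells of the dual arrangement and sign vectors -/

/-- The linear form that defines the line dual to `p`. -/
noncomputable def dualForm (p : ℝ × ℝ) : (Fin 3 → ℝ) →ₗ[ℝ] ℝ :=
  p.1 • LinearMap.proj 0 - LinearMap.proj 1 - p.2 • LinearMap.proj 2

theorem dualForm_apply (p : ℝ × ℝ) (v : Fin 3 → ℝ) :
    dualForm p v = p.1 * v 0 - v 1 - p.2 * v 2 := by
  simp [dualForm]

theorem mem_dualLine {p : ℝ × ℝ} {X : ProjPlane} : X ∈ dualLine p ↔ dualForm p X.rep = 0 := by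
  rw [dualForm_apply]; rfl

theorem continuous_dualForm (p : ℝ × ℝ) : Continuous (dualForm p) :=
  LinearMap.continuous_of_finiteDimensional _

theorem dualLine_injective : Function.Injective dualLine := by
  intro p q h
  have h1 : (![1, p.1, 0] : Fin 3 → ℝ) ≠ 0 := fun h => by simpa using congrFun h 0
  have h2 : (![0, -p.2, 1] : Fin 3 → ℝ) ≠ 0 := fun h => by simpa using congrFun h 2
  have e1 := (mk_mem_dualLine p _ h1).2 (by simp)
  have e2 := (mk_mem_dualLine p _ h2).2 (by simp)
  rw [h, mk_mem_dualLine] at e1 e2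
  simp at e1 e2
  ext <;> linarith

section

variable (f : ℕ → ℝ × ℝ) (H : Submodule ℝ (Fin 3 → ℝ)) (J : Set ℕ) (U : ℕ → Prop)

/-- The vectors at which the forms dual to the points of `U` are negative, and those dual to the
other points of `J` are positive. -/
def signCone : Set (Fin 3 → ℝ) :=
  {v | ∀ i ∈ J, (U i → dualForm (f i) v < 0) ∧ (¬ U i → 0 < dualForm (f i) v)}

/-- The points of the projective subspace `H` with sign vector `U` or its complement. -/
def cell : Set ProjPlane := {X | X.rep ∈ H ∧ (X.rep ∈ signCone f J U ∨ -X.rep ∈ signCone f J U)}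

/-- The points of the projective subspace `H` on none of the lines with indices in `J`. -/
def offLines : Set ProjPlane := {X | X.rep ∈ H ∧ ∀ i ∈ J, dualForm (f i) X.rep ≠ 0}

variable {f H J U}

theorem smul_mem_signCone {v : Fin 3 → ℝ} {c : ℝ} (hc : 0 < c) :
    c • v ∈ signCone f J U ↔ v ∈ signCone f J U := by
  have h : ∀ x, c * x < 0 ↔ x < 0 := fun x => by rw [← smul_eq_mul, smul_neg_iff_of_pos_left hc]
  simp only [signCone, Set.mem_ofPred_eq, map_smul, smul_eq_mul, mul_pos_iff_of_pos_left hc, h]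

theorem signCone_congr {W : ℕ → Prop} (h : ∀ i ∈ J, (U i ↔ W i)) :
    signCone f J U = signCone f J W := by
  ext v
  refine forall₂_congr fun i hi => ?_
  rw [h i hi]

theorem neg_mem_signCone {v : Fin 3 → ℝ} :
    -v ∈ signCone f J U ↔ v ∈ signCone f J fun i => ¬ U i := by
  refine forall₂_congr fun i hi => ?_
  simp only [map_neg, Left.neg_neg_iff, Left.neg_pos_iff, not_not]
  exact and_comm

theorem add_mem_signCone {v w : Fin 3 → ℝ} (hv : v ∈ signCone f J U) (hw : w ∈ signCone f J U) :
    v + w ∈ signCone f J U := by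
  intro i hi
  rw [map_add]
  exact ⟨fun h => add_neg ((hv i hi).1 h) ((hw i hi).1 h),
    fun h => add_pos ((hv i hi).2 h) ((hw i hi).2 h)⟩

theorem convex_signCone : Convex ℝ (signCone f J U) := by
  refine convex_iff_forall_pos.2 fun v hv w hw a b ha hb _ => ?_
  exact add_mem_signCone ((smul_mem_signCone ha).2 hv) ((smul_mem_signCone hb).2 hw)

theorem signCone_eq_of_mem {W : ℕ → Prop} {v : Fin 3 → ℝ} (hv : v ∈ signCone f J U)
    (hw : v ∈ signCone f J W) : ∀ i ∈ J, (U i ↔ W i) := by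
  intro i hi
  have h1 := hv i hi
  have h2 := hw i hi
  by_cases hU : U i <;> by_cases hW : W i <;> simp only [hU, hW]
  · exact absurd (h1.1 hU) (h2.2 hW).le.not_gt
  · exact absurd (h2.1 hW) (h1.2 hU).le.not_gt

theorem ne_zero_of_mem_signCone (hJ : J.Nonempty) {v : Fin 3 → ℝ} (hv : v ∈ signCone f J U) :
    v ≠ 0 := by
  rintro rfl
  obtain ⟨i, hi⟩ := hJ
  have := hv i hi
  by_cases h : U i
  · simpa using this.1 h
  · simpa using this.2 h

theorem isOpen_signCone (hJ : J.Finite) : IsOpen (signCone f J U) := by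
  have : signCone f J U = ⋂ i ∈ J,
      {v | (U i → dualForm (f i) v < 0) ∧ (¬ U i → 0 < dualForm (f i) v)} := by
    ext v; simp [signCone]
  rw [this]
  refine hJ.isOpen_biInter fun i _ => ?_
  by_cases h : U i
  · simpa [h] using isOpen_lt (continuous_dualForm _) continuous_const
  · simpa [h] using isOpen_lt continuous_const (continuous_dualForm _)

theorem mk_mem_cell {v : Fin 3 → ℝ} (hv : v ≠ 0) : Projectivization.mk ℝ v hv ∈ cell f H J U ↔
    v ∈ H ∧ (v ∈ signCone f J U ∨ -v ∈ signCone f J U) := by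
  obtain ⟨c, hc⟩ := Projectivization.exists_smul_eq_mk_rep ℝ v hv
  have h0 : (c : ℝ) ≠ 0 := c.ne_zero
  have hc' : (Projectivization.mk ℝ v hv).rep = (c : ℝ) • v := hc.symm
  simp only [cell, Set.mem_ofPred_eq]
  rw [hc', H.smul_mem_iff h0]
  refine and_congr_right fun _ => ?_
  rcases lt_or_gt_of_ne h0 with h | h
  · rw [show (c : ℝ) • v = (-(c : ℝ)) • (-v) by simp, ← smul_neg,
      smul_mem_signCone (by linarith), smul_mem_signCone (by linarith), neg_neg, or_comm]
  · rw [← smul_neg, smul_mem_signCone h, smul_mem_signCone h]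

theorem cell_congr {W : ℕ → Prop} (h : ∀ i ∈ J, (U i ↔ W i)) : cell f H J U = cell f H J W := by
  rw [cell, cell, signCone_congr h]

theorem cell_compl : cell f H J (fun i => ¬ U i) = cell f H J U := by
  ext X
  simp only [cell, Set.mem_ofPred_eq, ← neg_mem_signCone, neg_neg]
  rw [or_comm]

theorem cell_subset_offLines : cell f H J U ⊆ offLines f H J := by
  rintro X ⟨hH, h | h⟩
  · refine ⟨hH, fun i hi e => ?_⟩
    by_cases hU : U i
    · exact ((h i hi).1 hU).ne e
    · exact ((h i hi).2 hU).ne' e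
  · refine ⟨hH, fun i hi e => ?_⟩
    rw [neg_mem_signCone] at h
    by_cases hU : U i
    · exact ((h i hi).2 (not_not.2 hU)).ne' e
    · exact ((h i hi).1 hU).ne e

theorem exists_mem_cell {X : ProjPlane} (hX : X ∈ offLines f H J) :
    ∃ U, X.rep ∈ signCone f J U ∧ X ∈ cell f H J U := by
  have : X.rep ∈ signCone f J fun i => dualForm (f i) X.rep < 0 :=
    fun i hi => ⟨id, fun h => lt_of_le_of_ne (not_lt.1 h) (hX.2 i hi).symm⟩
  exact ⟨_, this, hX.1, .inl this⟩

/-- Cells with a common point have the same sign vector up to complement. -/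
theorem iff_or_iff_not_of_mem_cell {H' : Submodule ℝ (Fin 3 → ℝ)} {W : ℕ → Prop} {X : ProjPlane}
    (h : X ∈ cell f H J U) (h' : X ∈ cell f H' J W) :
    (∀ i ∈ J, (U i ↔ W i)) ∨ ∀ i ∈ J, (U i ↔ ¬ W i) := by
  rcases h.2 with h1 | h1 <;> rcases h'.2 with h2 | h2
  · exact .inl (signCone_eq_of_mem h1 h2)
  · exact .inr (signCone_eq_of_mem h1 (neg_mem_signCone.1 h2))
  · refine .inr fun i hi => ?_
    have := signCone_eq_of_mem (neg_mem_signCone.1 h1) h2 i hi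
    tauto
  · exact .inl (signCone_eq_of_mem h1 h2)

theorem cell_eq_of_iff {W : ℕ → Prop}
    (h : (∀ i ∈ J, (U i ↔ W i)) ∨ ∀ i ∈ J, (U i ↔ ¬ W i)) : cell f H J U = cell f H J W := by
  rcases h with h | h
  · exact cell_congr h
  · rw [cell_congr h, cell_compl]

/-! ### Topology of the cells: faces and edges as sign cells. -/

theorem continuous_mk' : Continuous (Projectivization.mk' ℝ : {v : Fin 3 → ℝ // v ≠ 0} → ProjPlane) :=
  continuous_quotient_mk' (s := projectivizationSetoid ℝ (Fin 3 → ℝ))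

/-- A convex cone is connected, and opposite vectors are the same projective point, so one of the
two opposite cones already covers the cell. -/
theorem isPreconnected_cell (hJ : J.Nonempty) : IsPreconnected (cell f H J U) := by
  have hconv : Convex ℝ ((H : Set (Fin 3 → ℝ)) ∩ signCone f J U) := H.convex.inter convex_signCone
  have := Subtype.preconnectedSpace hconv.isPreconnected
  let g : ((H : Set (Fin 3 → ℝ)) ∩ signCone f J U : Set (Fin 3 → ℝ)) → ProjPlane := fun w =>
    Projectivization.mk' ℝ ⟨w.1, ne_zero_of_mem_signCone hJ w.2.2⟩
  have hg : Continuous g := continuous_mk'.comp (continuous_subtype_val.subtype_mk _)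
  convert isPreconnected_range hg
  ext X
  constructor
  · rintro ⟨hH, h | h⟩
    · exact ⟨⟨X.rep, hH, h⟩, X.mk_rep⟩
    · refine ⟨⟨-X.rep, H.neg_mem hH, h⟩, ?_⟩
      conv_rhs => rw [← X.mk_rep]
      exact (Projectivization.mk_eq_mk_iff' ℝ _ _ _ _).2 ⟨-1, by simp⟩
  · rintro ⟨⟨v, hv, h⟩, rfl⟩
    exact (mk_mem_cell _).2 ⟨hv, .inl h⟩

theorem isOpen_cell_top (hJ : J.Finite) : IsOpen (cell f ⊤ J U) := by
  refine isOpen_coinduced.2 ?_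
  have : (Quotient.mk _ : {v : Fin 3 → ℝ // v ≠ 0} → ProjPlane) ⁻¹' cell f ⊤ J U =
      {w | w.1 ∈ signCone f J U ∨ -w.1 ∈ signCone f J U} := by
    ext w
    refine (mk_mem_cell w.2).trans ?_
    simp
  refine (congrArg IsOpen this).mpr ?_
  exact ((isOpen_signCone hJ).preimage continuous_subtype_val).union
    ((isOpen_signCone hJ).preimage continuous_subtype_val.neg)

/-- Cells in the whole projective plane are open and pairwise equal or disjoint, so a connected set
off the lines cannot leave its cell. The subspace `H` is arbitrary in order to treat faces (`⊤`) and
edges (the kernel of a form) at once. -/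
theorem connectedComponentIn_offLines (hJ : J.Nonempty) (hJ' : J.Finite) {X : ProjPlane}
    (hX : X ∈ cell f H J U) : connectedComponentIn (offLines f H J) X = cell f H J U := by
  refine Set.Subset.antisymm ?_
    ((isPreconnected_cell hJ).subset_connectedComponentIn hX cell_subset_offLines)
  have key : connectedComponentIn (offLines f H J) X ⊆ cell f ⊤ J U := by
    refine IsPreconnected.subset_left_of_subset_union (isOpen_cell_top hJ')
      (v := ⋃ W ∈ {W | Disjoint (cell f ⊤ J U) (cell f ⊤ J W)}, cell f ⊤ J W)
      (isOpen_biUnion fun W _ => isOpen_cell_top hJ') ?_ ?_ ?_ isPreconnected_connectedComponentIn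
    · exact Set.disjoint_iUnion₂_right.2 fun W hW => hW
    · intro Y hY
      have hY := connectedComponentIn_subset _ _ hY
      obtain ⟨W, hW, -⟩ := exists_mem_cell hY
      have hW : Y ∈ cell f ⊤ J W := ⟨trivial, .inl hW⟩
      by_cases hd : Disjoint (cell f ⊤ J U) (cell f ⊤ J W)
      · exact .inr (Set.mem_biUnion hd hW)
      · obtain ⟨Z, hZ, hZ'⟩ := Set.not_disjoint_iff.1 hd
        rw [cell_eq_of_iff (iff_or_iff_not_of_mem_cell hZ hZ')]
        exact .inl hW
    · exact ⟨X, mem_connectedComponentIn (cell_subset_offLines hX), trivial, hX.2⟩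
  intro Y hY
  exact ⟨(connectedComponentIn_subset _ _ hY).1, (key hY).2⟩

theorem compl_sUnion_dualArrangement : (⋃₀ dualArrangement (f '' J))ᶜ = offLines f ⊤ J := by
  ext X
  simp [dualArrangement, offLines, mem_dualLine]

theorem dualLine_diff (hf : Set.InjOn f J) {i : ℕ} (hi : i ∈ J) :
    dualLine (f i) \ ⋃₀ (dualArrangement (f '' J) \ {dualLine (f i)}) =
      offLines f (LinearMap.ker (dualForm (f i))) (J \ {i}) := by
  ext X
  simp only [Set.mem_sdiff, mem_dualLine, Set.mem_sUnion, offLines, Set.mem_ofPred_eq,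
    LinearMap.mem_ker]
  refine and_congr_right fun _ => ?_
  constructor
  · rintro h j ⟨hj, hji⟩ e
    refine h ⟨dualLine (f j), ⟨⟨f j, ⟨j, hj, rfl⟩, rfl⟩, fun h' => hji ?_⟩, mem_dualLine.2 e⟩
    exact hf hj hi (dualLine_injective h')
  · rintro h ⟨-, ⟨⟨-, ⟨j, hj, rfl⟩, rfl⟩, hji⟩, e⟩
    exact h j ⟨hj, fun e => hji (by rw [Set.mem_singleton_iff.1 e]; rfl)⟩ (mem_dualLine.1 e)

theorem isFace_iff (hJ : J.Nonempty) (hJ' : J.Finite) {F : Set ProjPlane} :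
    IsFace (dualArrangement (f '' J)) F ↔
      ∃ U, (signCone f J U).Nonempty ∧ F = cell f ⊤ J U := by
  rw [IsFace, compl_sUnion_dualArrangement]
  constructor
  · rintro ⟨X, hX, rfl⟩
    obtain ⟨U, h, h'⟩ := exists_mem_cell hX
    exact ⟨U, ⟨_, h⟩, connectedComponentIn_offLines hJ hJ' h'⟩
  · rintro ⟨U, ⟨v, hv⟩, rfl⟩
    have hX := (mk_mem_cell (H := ⊤) (ne_zero_of_mem_signCone hJ hv)).2 ⟨trivial, .inl hv⟩
    exact ⟨_, cell_subset_offLines hX, (connectedComponentIn_offLines hJ hJ' hX).symm⟩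

/-- The edges on the line dual to `f i`. -/
def edgeCell (f : ℕ → ℝ × ℝ) (J : Set ℕ) (U : ℕ → Prop) (i : ℕ) : Set ProjPlane :=
  cell f (LinearMap.ker (dualForm (f i))) (J \ {i}) U

/-- The vectors over the edge with sign vector `U` on the line dual to `f i`. -/
def edgeCone (f : ℕ → ℝ × ℝ) (J : Set ℕ) (U : ℕ → Prop) (i : ℕ) : Set (Fin 3 → ℝ) :=
  {v | dualForm (f i) v = 0 ∧ v ∈ signCone f (J \ {i}) U}

theorem isEdge_iff (hf : Set.InjOn f J) (hJ : J.Nontrivial) (hJ' : J.Finite) {e : Set ProjPlane} :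
    IsEdge (dualArrangement (f '' J)) e ↔
      ∃ i ∈ J, ∃ U, (edgeCone f J U i).Nonempty ∧ e = edgeCell f J U i := by
  have hne : ∀ i, (J \ {i}).Nonempty := fun i => by
    obtain ⟨j, hj, hji⟩ := hJ.exists_ne i
    exact ⟨j, hj, hji⟩
  have hfin : ∀ i, (J \ {i}).Finite := fun i => hJ'.sdiff
  constructor
  · rintro ⟨-, ⟨-, ⟨i, hi, rfl⟩, rfl⟩, X, hX, rfl⟩
    rw [dualLine_diff hf hi] at hX ⊢
    obtain ⟨U, h, h'⟩ := exists_mem_cell hX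
    exact ⟨i, hi, U, ⟨X.rep, hX.1, h⟩, connectedComponentIn_offLines (hne i) (hfin i) h'⟩
  · rintro ⟨i, hi, U, ⟨v, hv0, hv⟩, rfl⟩
    refine ⟨_, ⟨_, ⟨i, hi, rfl⟩, rfl⟩, ?_⟩
    rw [dualLine_diff hf hi]
    have hX := (mk_mem_cell (H := LinearMap.ker (dualForm (f i)))
      (ne_zero_of_mem_signCone (hne i) hv)).2 ⟨hv0, .inl hv⟩
    exact ⟨_, cell_subset_offLines hX, (connectedComponentIn_offLines (hne i) (hfin i) hX).symm⟩

theorem signCone_subset_diff {i : ℕ} : signCone f J U ⊆ signCone f (J \ {i}) U :=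
  fun _ hv j hj => hv j hj.1

/-- The dual point of the vertical direction does not lie on the dual lines. -/
theorem dualForm_single_one (p : ℝ × ℝ) : dualForm p (Pi.single 1 1) = -1 := by
  rw [dualForm_apply]
  simp

/-- A point of the edge is moved a little in the direction `(0, 1, 0)`, on which every form has the
value `-1`. The sign of the motion gives form `i` the value required by `U`; the strict signs of the
other forms persist. -/
theorem edgeCell_subset_closure (hJ : J.Nontrivial) (hJ' : J.Finite) {i : ℕ} :
    edgeCell f J U i ⊆ closure (cell f ⊤ J U) := by
  have hne : (J \ {i}).Nonempty := by
    obtain ⟨j, hj, hji⟩ := hJ.exists_ne i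
    exact ⟨j, hj, hji⟩
  have key : ∀ (v : Fin 3 → ℝ) (hv : v ≠ 0), dualForm (f i) v = 0 → v ∈ signCone f (J \ {i}) U →
      Projectivization.mk ℝ v hv ∈ closure (cell f ⊤ J U) := by
    intro v hv hv0 hvU
    obtain ⟨c, hc1, hc2⟩ : ∃ c : ℝ, (U i → 0 < c) ∧ (¬ U i → c < 0) := by
      by_cases h : U i
      · exact ⟨1, by simp [h]⟩
      · exact ⟨-1, by simp [h]⟩
    let γ : ℝ → Fin 3 → ℝ := fun t => v + t • (c • Pi.single 1 1)
    have hγ : Continuous γ := by fun_prop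
    have hγ0 : γ 0 = v := by simp [γ]
    have hev : ∀ᶠ t in nhdsWithin (0 : ℝ) (Set.Ioi 0), γ t ∈ signCone f (J \ {i}) U := by
      refine nhdsWithin_le_nhds (hγ.continuousAt.eventually_mem ?_)
      rw [hγ0]
      exact (isOpen_signCone hJ'.sdiff).mem_nhds hvU
    have hne' : ∀ᶠ t in nhds (0 : ℝ), γ t ≠ 0 :=
      hγ.continuousAt.eventually_ne (by rwa [hγ0])
    rw [mem_closure_iff]
    intro o ho hvo
    have ho' : IsOpen ((Projectivization.mk' ℝ : {v : Fin 3 → ℝ // v ≠ 0} → ProjPlane) ⁻¹' o) :=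
      ho.preimage continuous_mk'
    obtain ⟨o', ho', e⟩ := isOpen_induced_iff.1 ho'
    have hmem : ∀ w (hw : w ≠ 0), w ∈ o' ↔ Projectivization.mk ℝ w hw ∈ o := fun w hw =>
      Set.ext_iff.1 e ⟨w, hw⟩
    have hev2 : ∀ᶠ t in nhds (0 : ℝ), γ t ∈ o' := by
      refine hγ.continuousAt.eventually_mem (ho'.mem_nhds ?_)
      rw [hγ0]
      exact (hmem v hv).2 hvo
    have hpos : ∀ᶠ t in nhdsWithin (0 : ℝ) (Set.Ioi 0), 0 < t := self_mem_nhdsWithin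
    obtain ⟨t, ht0, ht1, ht2, ht3⟩ := (hpos.and (hev.and
      (nhdsWithin_le_nhds (hne'.and hev2)))).exists
    refine ⟨_, (hmem _ ht2).1 ht3, (mk_mem_cell ht2).2 ⟨trivial, .inl fun j hj => ?_⟩⟩
    by_cases hji : j = i
    · subst hji
      have : dualForm (f j) (γ t) = -(t * c) := by
        simp [γ, hv0, dualForm_single_one]
      rw [this]
      exact ⟨fun h => by have := mul_pos ht0 (hc1 h); linarith,
        fun h => by have := mul_neg_of_pos_of_neg ht0 (hc2 h); linarith⟩
    · exact ht1 j ⟨hj, hji⟩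
  rintro X ⟨h0, h | h⟩
  · rw [← X.mk_rep]
    exact key _ _ h0 h
  · rw [← X.mk_rep, (Projectivization.mk_eq_mk_iff' ℝ X.rep (-X.rep) _
      (neg_ne_zero.2 X.rep_nonzero)).2 ⟨-1, by simp⟩]
    exact key _ _ (by simpa using h0) h

/-- When line `i` is removed, the edge lies in an open cell of the plane. If it touches the closure
of the face, this cell meets the face itself. -/
theorem iff_of_edgeCell_subset_closure (hJ' : J.Finite) {i : ℕ} {W : ℕ → Prop} {X : ProjPlane}
    (hX : X ∈ edgeCell f J W i) (hX' : X ∈ closure (cell f ⊤ J U)) :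
    (∀ j ∈ J \ {i}, (W j ↔ U j)) ∨ ∀ j ∈ J \ {i}, (W j ↔ ¬ U j) := by
  have hX : X ∈ cell f ⊤ (J \ {i}) W := ⟨Submodule.mem_top, hX.2⟩
  obtain ⟨Y, hY, hY'⟩ := mem_closure_iff.1 hX' _ (isOpen_cell_top hJ'.sdiff) hX
  have hYU : Y ∈ cell f ⊤ (J \ {i}) U :=
    ⟨Submodule.mem_top, hY'.2.imp (fun h => signCone_subset_diff h) fun h => signCone_subset_diff h⟩
  exact iff_or_iff_not_of_mem_cell hY hYU

theorem edgeCell_nonempty (hJ : J.Nontrivial) {i : ℕ} (h : (edgeCone f J U i).Nonempty) :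
    (edgeCell f J U i).Nonempty := by
  obtain ⟨v, hv0, hv⟩ := h
  obtain ⟨j, hj, hji⟩ := hJ.exists_ne i
  have hne : (J \ {i}).Nonempty := ⟨j, hj, hji⟩
  exact ⟨_, (mk_mem_cell (ne_zero_of_mem_signCone hne hv)).2 ⟨hv0, .inl hv⟩⟩

/-- An edge in the closure of the face inherits the sign vector of the face up to complement, so
each line carries at most one. Edges on different lines differ, because an edge avoids all the other
lines. Hence counting edges amounts to counting lines. -/
theorem numEdges_cell (hf : Set.InjOn f J) (hJ : J.Nontrivial) (hJ' : J.Finite) :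
    numEdges (dualArrangement (f '' J)) (cell f ⊤ J U) =
      {i ∈ J | (edgeCone f J U i).Nonempty}.encard := by
  have himg : {e | IsEdge (dualArrangement (f '' J)) e ∧ e ⊆ closure (cell f ⊤ J U)} =
      edgeCell f J U '' {i ∈ J | (edgeCone f J U i).Nonempty} := by
    ext e
    simp only [isEdge_iff hf hJ hJ', Set.mem_ofPred_eq, Set.mem_image]
    constructor
    · rintro ⟨⟨i, hi, W, hW, rfl⟩, hcl⟩
      obtain ⟨X, hX⟩ := edgeCell_nonempty hJ hW
      have h := iff_of_edgeCell_subset_closure hJ' hX (hcl hX)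
      refine ⟨i, ⟨hi, ?_⟩, (cell_eq_of_iff h).symm⟩
      obtain ⟨v, hv0, hv⟩ := hW
      rcases h with h | h
      · exact ⟨v, hv0, signCone_congr h ▸ hv⟩
      · refine ⟨-v, by simpa using hv0, ?_⟩
        rw [neg_mem_signCone, ← signCone_congr h]
        exact hv
    · rintro ⟨i, ⟨hi, h⟩, rfl⟩
      exact ⟨⟨i, hi, U, h, rfl⟩, edgeCell_subset_closure hJ hJ'⟩
  rw [numEdges, himg, Set.InjOn.encard_image]
  rintro i ⟨hi, h⟩ j ⟨hj, h'⟩ e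
  by_contra hij
  obtain ⟨X, hX⟩ := edgeCell_nonempty hJ h
  have hX' : X ∈ edgeCell f J U j := e ▸ hX
  exact (cell_subset_offLines hX).2 j ⟨hj, Ne.symm hij⟩ hX'.1

end

/-! ### Sign vectors of the faces of a realization -/

/-- The determinant whose sign is the orientation of the triangle `pqr`. -/
def orient (p q r : ℝ × ℝ) : ℝ := (q.1 - p.1) * (r.2 - p.2) - (q.2 - p.2) * (r.1 - p.1)

/-- The points `f 0, …, f (2 ^ s)` have the order type of the Koch chain `K_s`. -/
structure IsRealization (s : ℕ) (f : ℕ → ℝ × ℝ) : Prop where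
  lt : ∀ i j, i < j → j ≤ 2 ^ s → (f i).1 < (f j).1
  above : ∀ p q r, p < q → q ≤ 2 ^ s → r ≤ 2 ^ s → r ≠ p → r ≠ q →
    (Above s p q r → 0 < orient (f p) (f q) (f r)) ∧
    (¬ Above s p q r → orient (f p) (f q) (f r) < 0)

/-- The vector dual to the line through `p` and `q`. -/
def lineVec (p q : ℝ × ℝ) : Fin 3 → ℝ :=
  ![q.2 - p.2, p.1 * (q.2 - p.2) - p.2 * (q.1 - p.1), q.1 - p.1]

/-- For `p` to the left of `q`, the form is negative exactly for points `r` above the line; this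
fixes the sign convention of `signCone`. -/
theorem dualForm_lineVec (p q r : ℝ × ℝ) : dualForm r (lineVec p q) = -orient p q r := by
  rw [dualForm_apply]
  simp [lineVec, orient]
  ring

theorem exists_smul_eq_of_dualForm {p q : ℝ × ℝ} (hpq : p.1 ≠ q.1) {u z : Fin 3 → ℝ} (hu : u ≠ 0)
    (hpu : dualForm p u = 0) (hqu : dualForm q u = 0) (hpz : dualForm p z = 0)
    (hqz : dualForm q z = 0) : ∃ c : ℝ, z = c • u := by
  rw [dualForm_apply] at *
  have hd : p.1 - q.1 ≠ 0 := sub_ne_zero.2 hpq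
  have h2 : u 2 ≠ 0 := by
    intro h2
    have h0 : u 0 = 0 := by
      have : (p.1 - q.1) * u 0 = 0 := by rw [h2] at hpu hqu; linarith
      simpa [hd] using this
    have h1 : u 1 = 0 := by rw [h2, h0] at hpu; linarith
    exact hu (by ext i; fin_cases i <;> simp [h0, h1, h2])
  have h0 : z 0 * u 2 = u 0 * z 2 := by
    refine mul_left_cancel₀ hd ?_
    linear_combination (hpz - hqz) * u 2 - (hpu - hqu) * z 2
  have h1 : z 1 * u 2 = u 1 * z 2 := by
    linear_combination p.1 * h0 - hpz * u 2 + hpu * z 2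
  refine ⟨z 2 / u 2, ?_⟩
  ext i
  fin_cases i <;> simp <;> field_simp <;> linarith

/-- A cycle of vertices of a polyhedral cone in space determines its facets. -/
theorem facets_of_cycle {V : Type*} [AddCommGroup V] [Module ℝ V] (L : ℕ → V →ₗ[ℝ] ℝ)
    {J T : Finset ℕ} (hTJ : T ⊆ J) (hTne : T.Nonempty)
    (hdim : ∀ i ∈ J, ∀ j ∈ J, i ≠ j → ∀ u z, u ≠ 0 → L i u = 0 → L j u = 0 → L i z = 0 →
      L j z = 0 → ∃ c : ℝ, z = c • u)
    (hT : ∀ p ∈ T, ∃ q ∈ T, ∃ q' ∈ T, q ≠ q' ∧ p ≠ q ∧ p ≠ q' ∧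
      (∃ u, L p u = 0 ∧ L q u = 0 ∧ ∀ r ∈ J, r ≠ p → r ≠ q → 0 < L r u) ∧
      (∃ u, L p u = 0 ∧ L q' u = 0 ∧ ∀ r ∈ J, r ≠ p → r ≠ q' → 0 < L r u)) :
    (∀ r ∈ J, (∃ w, L r w = 0 ∧ ∀ i ∈ J, i ≠ r → 0 < L i w) ↔ r ∈ T) ∧
      ∃ v, ∀ i ∈ J, 0 < L i v := by
  classical
  set N : ℕ → ℕ → V → Prop := fun p q u =>
    L p u = 0 ∧ L q u = 0 ∧ ∀ r ∈ J, r ≠ p → r ≠ q → 0 < L r u with hN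
  have hnext : ∀ p ∈ T, ∀ q, ∃ q' ∈ T, q' ≠ q ∧ p ≠ q' ∧ ∃ u, N p q' u := by
    intro p hp q
    obtain ⟨q1, hq1, q2, hq2, hne, hp1, hp2, h1, h2⟩ := hT p hp
    by_cases h : q1 = q
    · exact ⟨q2, hq2, fun e => hne (h.trans e.symm), hp2, h2⟩
    · exact ⟨q1, hq1, h, hp1, h1⟩
  have hnn : ∀ p q u, N p q u → ∀ r ∈ J, 0 ≤ L r u := by
    intro p q u h r hr
    by_cases h1 : r = p
    · rw [h1, h.1]
    by_cases h2 : r = q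
    · rw [h2, h.2.1]
    exact (h.2.2 r hr h1 h2).le
  refine ⟨fun r hr => ⟨?_, fun hrT => ?_⟩, ?_⟩
  · rintro ⟨w, hrw, hw⟩
    by_contra hrT
    have hu : ∀ p : ℕ × ℕ, ∃ u, (∃ u, N p.1 p.2 u) → N p.1 p.2 u := by
      intro p
      by_cases h : ∃ u, N p.1 p.2 u
      · exact ⟨h.choose, fun _ => h.choose_spec⟩
      · exact ⟨0, fun h' => absurd h' h⟩
    choose u hu using hu
    -- The sum of the forms is positive at the vertices in `S` and at `w`; it normalizes `L r`, so
    -- that the ratio can be minimized over the finitely many vertices.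
    set φ : V →ₗ[ℝ] ℝ := ∑ i ∈ J, L i with hφ
    have hφ_apply : ∀ v, φ v = ∑ i ∈ J, L i v := fun v => by simp [hφ]
    set S := (T ×ˢ T).filter fun p => p.1 ≠ p.2 ∧ ∃ u, N p.1 p.2 u with hS
    have hmemS : ∀ p q, p ∈ T → q ∈ T → p ≠ q → (∃ u, N p q u) → (p, q) ∈ S := by
      intro p q hp hq hne h
      rw [hS, Finset.mem_filter, Finset.mem_product]
      exact ⟨⟨hp, hq⟩, hne, h⟩
    have hSne : S.Nonempty := by
      obtain ⟨p, hp⟩ := hTne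
      obtain ⟨q, hq, -, hne, h⟩ := hnext p hp p
      exact ⟨_, hmemS p q hp hq hne h⟩
    obtain ⟨⟨i, j⟩, hij, hmin⟩ := S.exists_min_image (fun p => L r (u p) / φ (u p)) hSne
    have hpos : ∀ p ∈ S, 0 < L r (u p) ∧ 0 < φ (u p) := by
      intro p hp
      rw [hS, Finset.mem_filter, Finset.mem_product] at hp
      have h := hu p hp.2.2
      have h1 : 0 < L r (u p) := h.2.2 r hr (fun e => hrT (e ▸ hp.1.1)) (fun e => hrT (e ▸ hp.1.2))
      refine ⟨h1, ?_⟩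
      rw [hφ_apply]
      exact Finset.sum_pos' (fun k hk => hnn _ _ _ h k hk) ⟨r, hr, h1⟩
    set c := L r (u (i, j)) / φ (u (i, j)) with hc
    have hc0 : 0 < c := div_pos (hpos _ hij).1 (hpos _ hij).2
    set g : V →ₗ[ℝ] ℝ := L r - c • φ with hg
    have hg_apply : ∀ v, g v = L r v - c * φ v := fun v => by simp [hg]
    have hgS : ∀ p ∈ S, 0 ≤ g (u p) := by
      intro p hp
      have := hmin p hp
      rw [hg_apply]
      rw [le_div_iff₀ (hpos p hp).2] at this
      linarith
    have hgij : g (u (i, j)) = 0 := by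
      rw [hg_apply, hc, div_mul_cancel₀ _ (hpos _ hij).2.ne', sub_self]
    have hij' := hij
    rw [hS, Finset.mem_filter, Finset.mem_product] at hij'
    obtain ⟨⟨hi, hj⟩, hne, hNij⟩ := hij'
    simp only at hi hj hne hNij
    -- These are the two neighbours of the minimal vertex along the cycle, one on facet `j` and one
    -- on facet `i`.
    obtain ⟨i', hi', hi'i, hji', hN1⟩ := hnext j hj i
    obtain ⟨j', hj', hj'j, hij', hN2⟩ := hnext i hi j
    have h1 := hgS _ (hmemS _ _ hj hi' hji' hN1)
    have h2 := hgS _ (hmemS _ _ hi hj' hij' hN2)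
    have hu0 := hu (i, j) hNij
    have hu1 := hu (j, i') hN1
    have hu2 := hu (i, j') hN2
    have hiu : 0 < L i (u (j, i')) := hu1.2.2 i (hTJ hi) hne hi'i.symm
    have hju : 0 < L j (u (i, j')) := hu2.2.2 j (hTJ hj) hne.symm hj'j.symm
    have hiw : 0 < L i w := hw i (hTJ hi) fun e => hrT (e ▸ hi)
    have hjw : 0 < L j w := hw j (hTJ hj) fun e => hrT (e ▸ hj)
    have hune : u (i, j) ≠ 0 := fun e => (hpos _ hij).1.ne' (by rw [e, map_zero])
    -- A local minimum is global: after subtraction of positive multiples of the neighbours, `w`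
    -- lies on both `L i = 0` and `L j = 0`, and is thus a multiple of the minimal vertex, where `g
    -- = 0`. This gives `g w ≥ 0`, whereas `L r w = 0` gives `g w = -c * φ w < 0`.
    obtain ⟨d, hd⟩ := hdim i (hTJ hi) j (hTJ hj) hne (u (i, j))
      (w - (L i w / L i (u (j, i'))) • u (j, i') - (L j w / L j (u (i, j'))) • u (i, j')) hune
      hu0.1 hu0.2.1
      (by
        have := hu2.1
        simp only at this
        simp [this, div_mul_cancel₀ _ hiu.ne'])
      (by
        have := hu1.1
        simp only at this
        simp [this, div_mul_cancel₀ _ hju.ne'])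
    have hgw := congrArg g hd
    simp only [map_sub, map_smul, smul_eq_mul, hgij, mul_zero] at hgw
    have h3 := mul_nonneg (div_pos hiw hiu).le h1
    have h4 := mul_nonneg (div_pos hjw hju).le h2
    have hφw : 0 < φ w := by
      rw [hφ_apply]
      refine Finset.sum_pos' (fun k hk => ?_) ⟨i, hTJ hi, hiw⟩
      by_cases hk' : k = r
      · rw [hk', hrw]
      · exact (hw k hk hk').le
    have := mul_pos hc0 hφw
    rw [hg_apply w, hrw] at hgw
    linarith
  · obtain ⟨q, hq, q', hq', hne, hrq, hrq', ⟨u, hu⟩, ⟨u', hu'⟩⟩ := hT r hrT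
    -- The sum of two different vertices on a facet lies in its relative interior.
    refine ⟨u + u', by rw [map_add, hu.1, hu'.1, add_zero], fun i hi hir => ?_⟩
    rw [map_add]
    by_cases h : i = q
    · exact add_pos_of_nonneg_of_pos (hnn _ _ _ hu i hi) (hu'.2.2 i hi hir (h ▸ hne))
    · exact add_pos_of_pos_of_nonneg (hu.2.2 i hi hir h) (hnn _ _ _ hu' i hi)
  · obtain ⟨p, hp⟩ := hTne
    obtain ⟨q, hq, q', hq', hne, hrq, hrq', ⟨u, hu⟩, ⟨u', hu'⟩⟩ := hT p hp
    obtain ⟨p', hp', hp'p, hqp', u2, hu2⟩ := hnext q hq p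
    -- Two vertices on facet `p` and a third one off it add up to an interior vector.
    refine ⟨u + u' + u2, fun i hi => ?_⟩
    rw [map_add, map_add]
    have a1 := hnn _ _ _ hu i hi
    have a2 := hnn _ _ _ hu' i hi
    have a3 := hnn _ _ _ hu2 i hi
    by_cases h1 : i = p
    · have := hu2.2.2 i hi (h1 ▸ hrq) (h1 ▸ hp'p.symm)
      linarith
    by_cases h2 : i = q
    · have := hu'.2.2 i hi h1 (h2 ▸ hne)
      linarith
    · have := hu.2.2 i hi h1 h2
      linarith

namespace IsRealization

variable {s : ℕ} {f : ℕ → ℝ × ℝ}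

theorem fst_ne (hf : IsRealization s f) {i j : ℕ} (hi : i ≤ 2 ^ s) (hj : j ≤ 2 ^ s) (hij : i ≠ j) :
    (f i).1 ≠ (f j).1 := by
  rcases lt_or_gt_of_ne hij with h | h
  · exact (hf.lt _ _ h hj).ne
  · exact (hf.lt _ _ h hi).ne'

theorem injOn (hf : IsRealization s f) : Set.InjOn f (Set.Iic (2 ^ s)) := fun i hi j hj e => by
  by_contra h
  exact hf.fst_ne hi hj h (congrArg Prod.fst e)

/-- A vertex of the face `U` is a common zero of two of the forms with the right signs at the
other forms. -/
theorem exists_vec_of_isVertex (hf : IsRealization s f) {U : ℕ → Prop} {p q : ℕ} (h : IsVertex s U p q) :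
    ∃ u, dualForm (f p) u = 0 ∧ dualForm (f q) u = 0 ∧
      u ∈ signCone f (Set.Iic (2 ^ s) \ {p, q}) U := by
  wlog hpq : p < q generalizing p q
  · obtain ⟨u, h1, h2, h3⟩ := this h.symm (lt_of_le_of_ne (not_lt.1 hpq) h.2.2.1.symm)
    exact ⟨u, h2, h1, by rwa [Set.pair_comm]⟩
  refine ⟨lineVec (f p) (f q), ?_, ?_, ?_⟩
  · rw [dualForm_lineVec, orient]; ring
  · rw [dualForm_lineVec, orient]; ring
  · rintro r ⟨hr, hr'⟩
    simp only [Set.mem_insert_iff, Set.mem_singleton_iff, not_or] at hr'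
    obtain ⟨h1, h2⟩ := hf.above p q r hpq h.2.1 hr hr'.1 hr'.2
    rw [dualForm_lineVec, h.2.2.2 r hr hr'.1 hr'.2]
    exact ⟨fun h => neg_neg_of_pos (h1 h), fun h => neg_pos_of_neg (h2 h)⟩

/-- After the forms of the points in `U` change sign, the face is a cone of positive forms and
`facets_of_cycle` applies. A vertex for the complement of `U` is represented by the negative of its
vector. -/
theorem of_isFaceCycle (hf : IsRealization s f) {U : ℕ → Prop} {T : Finset ℕ} (h : IsFaceCycle s U T) :
    {i ∈ Set.Iic (2 ^ s) | (edgeCone f (Set.Iic (2 ^ s)) U i).Nonempty} = ↑T ∧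
      (signCone f (Set.Iic (2 ^ s)) U).Nonempty := by
  classical
  set L : ℕ → (Fin 3 → ℝ) →ₗ[ℝ] ℝ := fun i => (if U i then (-1 : ℝ) else 1) • dualForm (f i)
    with hL
  have hLpos : ∀ i v, 0 < L i v ↔ (U i → dualForm (f i) v < 0) ∧ (¬ U i → 0 < dualForm (f i) v) := by
    intro i v
    by_cases hU : U i <;> simp [hL, hU]
  have hLzero : ∀ i v, L i v = 0 ↔ dualForm (f i) v = 0 := by
    intro i v
    by_cases hU : U i <;> simp [hL, hU]
  have hvec : ∀ p q, (IsVertex s U p q ∨ IsVertex s (fun r => ¬ U r) p q) →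
      p ≠ q ∧ ∃ u, L p u = 0 ∧ L q u = 0 ∧ ∀ r ∈ Finset.Iic (2 ^ s), r ≠ p → r ≠ q → 0 < L r u := by
    rintro p q (h | h)
    · obtain ⟨u, h1, h2, h3⟩ := hf.exists_vec_of_isVertex h
      refine ⟨h.2.2.1, u, (hLzero _ _).2 h1, (hLzero _ _).2 h2, fun r hr hp hq => ?_⟩
      exact (hLpos r u).2 (h3 r ⟨Finset.mem_Iic.1 hr, by simp [hp, hq]⟩)
    · obtain ⟨u, h1, h2, h3⟩ := hf.exists_vec_of_isVertex h
      refine ⟨h.2.2.1, -u, (hLzero _ _).2 (by simpa using h1), (hLzero _ _).2 (by simpa using h2),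
        fun r hr hp hq => ?_⟩
      rw [← neg_mem_signCone] at h3
      exact (hLpos r _).2 (h3 r ⟨Finset.mem_Iic.1 hr, by simp [hp, hq]⟩)
  have hTle : ∀ p ∈ T, p ≤ 2 ^ s := by
    intro p hp
    obtain ⟨q, hq, q', hq', -, h1 | h1, -⟩ := h.2 p hp <;> exact h1.1
  obtain ⟨h1, v, hv⟩ := facets_of_cycle L (J := Finset.Iic (2 ^ s)) (T := T)
    (fun p hp => Finset.mem_Iic.2 (hTle p hp)) h.1
    (fun i hi j hj hij u z hu h1 h2 h3 h4 => exists_smul_eq_of_dualForm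
      (hf.fst_ne (Finset.mem_Iic.1 hi) (Finset.mem_Iic.1 hj) hij) hu ((hLzero _ _).1 h1)
      ((hLzero _ _).1 h2) ((hLzero _ _).1 h3) ((hLzero _ _).1 h4))
    (fun p hp => by
      obtain ⟨q, hq, q', hq', hne, h1, h2⟩ := h.2 p hp
      exact ⟨q, hq, q', hq', hne, (hvec _ _ h1).1, (hvec _ _ h2).1, (hvec _ _ h1).2,
        (hvec _ _ h2).2⟩)
  refine ⟨?_, v, fun i hi => (hLpos i v).1 (hv i (Finset.mem_Iic.2 hi))⟩
  ext r
  simp only [Set.mem_ofPred_eq, Finset.mem_coe]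
  constructor
  · rintro ⟨hr, w, hw0, hw⟩
    exact (h1 r (Finset.mem_Iic.2 hr)).1 ⟨w, (hLzero _ _).2 hw0, fun i hi hir =>
      (hLpos i w).2 (hw i ⟨Finset.mem_Iic.1 hi, hir⟩)⟩
  · intro hr
    obtain ⟨w, hw0, hw⟩ := (h1 r (Finset.mem_Iic.2 (hTle r hr))).2 hr
    exact ⟨hTle r hr, w, (hLzero _ _).1 hw0, fun i hi =>
      (hLpos i w).1 (hw i (Finset.mem_Iic.2 hi.1) hi.2)⟩

/-- A pair of maximal slope with `i` above and `j` below determines the sign vector. -/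
theorem iff_rotated (hf : IsRealization s f) {W : ℕ → Prop} {i j : ℕ} (hij : i < j) (hj : j ≤ 2 ^ s) (hWi : W i)
    (hWj : ¬ W j)
    (hmax : ∀ i' j', i' < j' → j' ≤ 2 ^ s → W i' → ¬ W j' →
      ((f j').2 - (f i').2) / ((f j').1 - (f i').1) ≤ ((f j).2 - (f i).2) / ((f j).1 - (f i).1))
    (hside : ∀ r ≤ 2 ^ s, (W r → j < r → 0 < orient (f i) (f j) (f r)) ∧
      (¬ W r → r < i → orient (f i) (f j) (f r) < 0)) :
    ∀ r ≤ 2 ^ s, (W r ↔ rotated s i j r) := by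
  intro r hr
  have hxij := hf.lt i j hij hj
  rw [rotated]
  by_cases hri : r = i
  · subst hri; simp [hWi]
  by_cases hrj : r = j
  · subst hrj; simp [hWj, hri]
  obtain ⟨h1, h2⟩ := hf.above i j r hij hj hr hri hrj
  simp only [hri, hrj, false_or, ne_eq, not_false_eq_true, true_and]
  constructor
  · intro hW
    by_contra hA
    have ho := h2 hA
    -- If `r` is left of `j` and below the line `ij`, then `rj` is steeper than `ij`, against
    -- maximality.
    rcases lt_or_gt_of_ne hrj with hlt | hgt
    · have hx := hf.lt r j hlt hj
      have := hmax r j hlt hj hW hWj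
      rw [div_le_div_iff₀ (by linarith) (by linarith)] at this
      rw [orient] at ho
      linarith
    · exact lt_asymm ho ((hside r hr).1 hW hgt)
  · intro hA
    by_contra hW
    have ho := h1 hA
    rcases lt_or_gt_of_ne hri with hlt | hgt
    · exact lt_asymm ho ((hside r hr).2 hW hlt)
    · have hx := hf.lt i r hgt hr
      have := hmax i r hgt hr hWi hW
      rw [div_le_div_iff₀ (by linarith) (by linarith)] at this
      rw [orient] at ho
      linarith

theorem exists_maxSlope {W : ℕ → Prop} (h : ∃ i j, i < j ∧ j ≤ 2 ^ s ∧ W i ∧ ¬ W j) :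
    ∃ i j, i < j ∧ j ≤ 2 ^ s ∧ W i ∧ ¬ W j ∧ ∀ i' j', i' < j' → j' ≤ 2 ^ s → W i' → ¬ W j' →
      ((f j').2 - (f i').2) / ((f j').1 - (f i').1) ≤
        ((f j).2 - (f i).2) / ((f j).1 - (f i).1) := by
  classical
  obtain ⟨i, j, hij, hj, hi, hj'⟩ := h
  obtain ⟨⟨a, b⟩, hab, hmax⟩ := ((pairs s).filter fun x => W x.1 ∧ ¬ W x.2).exists_max_image
    (fun x => ((f x.2).2 - (f x.1).2) / ((f x.2).1 - (f x.1).1))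
    ⟨(i, j), Finset.mem_filter.2 ⟨mem_pairs.2 ⟨hij, hj⟩, hi, hj'⟩⟩
  rw [Finset.mem_filter, mem_pairs] at hab
  exact ⟨a, b, hab.1.1, hab.1.2, hab.2.1, hab.2.2, fun i' j' h1 h2 h3 h4 =>
    hmax (i', j') (Finset.mem_filter.2 ⟨mem_pairs.2 ⟨h1, h2⟩, h3, h4⟩)⟩

/-- A vector with `v 2 > 0` is a non-vertical line with the points of `U` above it. It is steeper
than every `ij` with `i < j`, `i` above and `j` below, so the steepest such pair is the limit of
turning clockwise. If there is no such pair, `U` is a final segment. Its complement then has such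
pairs, and the side conditions hold vacuously. -/
theorem exists_rotated_of_pos (hf : IsRealization s f) {U : ℕ → Prop} {v : Fin 3 → ℝ}
    (hv : v ∈ signCone f (Set.Iic (2 ^ s)) U) (hv2 : 0 < v 2) (h1 : ∃ i ≤ 2 ^ s, U i)
    (h2 : ∃ j ≤ 2 ^ s, ¬ U j) :
    ∃ i j, i < j ∧ j ≤ 2 ^ s ∧ ((∀ r ∈ Set.Iic (2 ^ s), (U r ↔ rotated s i j r)) ∨
      ∀ r ∈ Set.Iic (2 ^ s), (U r ↔ ¬ rotated s i j r)) := by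
  by_cases h : ∃ i j, i < j ∧ j ≤ 2 ^ s ∧ U i ∧ ¬ U j
  · obtain ⟨i, j, hij, hj, hi, hj', hmax⟩ := exists_maxSlope (f := f) h
    refine ⟨i, j, hij, hj, .inl (hf.iff_rotated hij hj hi hj' hmax fun r hr => ?_)⟩
    have hxij := hf.lt i j hij hj
    -- The orientation of three points is a combination of their vertical distances from the line
    -- `v`, with coefficients given by differences of x-coordinates.
    have key : v 2 * orient (f i) (f j) (f r) = ((f r).1 - (f i).1) * dualForm (f j) v -
        ((f r).1 - (f j).1) * dualForm (f i) v - ((f j).1 - (f i).1) * dualForm (f r) v := by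
      rw [orient, dualForm_apply, dualForm_apply, dualForm_apply]
      ring
    have hvi := (hv i (hij.le.trans hj)).1 hi
    have hvj := (hv j hj).2 hj'
    constructor
    · intro hU hjr
      have hvr := (hv r hr).1 hU
      have hx := hf.lt j r hjr hr
      refine pos_of_mul_pos_right (?_ : 0 < v 2 * _) hv2.le
      rw [key]
      have a1 := mul_pos (show 0 < (f r).1 - (f i).1 by linarith) hvj
      have a2 := mul_neg_of_pos_of_neg (show 0 < (f r).1 - (f j).1 by linarith) hvi
      have a3 := mul_neg_of_pos_of_neg (show 0 < (f j).1 - (f i).1 by linarith) hvr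
      linarith
    · intro hU hri
      have hvr := (hv r hr).2 hU
      have hx := hf.lt r i hri (hij.le.trans hj)
      refine neg_of_mul_neg_right (?_ : v 2 * _ < 0) hv2.le
      rw [key]
      have a1 := mul_neg_of_neg_of_pos (show (f r).1 - (f i).1 < 0 by linarith) hvj
      have a2 := mul_pos_of_neg_of_neg (show (f r).1 - (f j).1 < 0 by linarith) hvi
      have a3 := mul_pos (show 0 < (f j).1 - (f i).1 by linarith) hvr
      linarith
  · push Not at h
    obtain ⟨a, ha, hUa⟩ := h1
    obtain ⟨b, hb, hUb⟩ := h2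
    have hba : b < a := by
      rcases lt_trichotomy a b with hab | rfl | hab
      · exact absurd (h a b hab hb hUa) hUb
      · exact absurd hUa hUb
      · exact hab
    obtain ⟨i, j, hij, hj, hi, hj', hmax⟩ := exists_maxSlope (f := f) (W := fun r => ¬ U r)
      ⟨b, a, hba, ha, hUb, not_not.2 hUa⟩
    refine ⟨i, j, hij, hj, .inr fun r hr => ?_⟩
    rw [← hf.iff_rotated hij hj hi hj' hmax _ r hr, not_not]
    intro r hr
    exact ⟨fun h1 h2 => absurd (h _ _ h2 hr (not_not.1 hj')) h1,
      fun h1 h2 => absurd (h _ _ h2 (hij.le.trans hj) (not_not.1 h1)) hi⟩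

/-- Every sign vector of a face, except for the constant ones, comes from a pair. -/
theorem exists_rotated (hf : IsRealization s f) {U : ℕ → Prop} (hU : (signCone f (Set.Iic (2 ^ s)) U).Nonempty)
    (h1 : ∃ i ≤ 2 ^ s, U i) (h2 : ∃ j ≤ 2 ^ s, ¬ U j) :
    ∃ i j, i < j ∧ j ≤ 2 ^ s ∧ ((∀ r ∈ Set.Iic (2 ^ s), (U r ↔ rotated s i j r)) ∨
      ∀ r ∈ Set.Iic (2 ^ s), (U r ↔ ¬ rotated s i j r)) := by
  -- The cone is open, so a vector at infinity can be moved off it. For `v 2 < 0` the opposite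
  -- vector and the complement of `U` are used.
  obtain ⟨v, hv, hv2⟩ : ∃ v ∈ signCone f (Set.Iic (2 ^ s)) U, v 2 ≠ 0 := by
    obtain ⟨v, hv⟩ := hU
    by_cases hv2 : v 2 = 0
    · let γ : ℝ → Fin 3 → ℝ := fun t => v + t • Pi.single 2 1
      have hγ : Continuous γ := by fun_prop
      have hev : ∀ᶠ t in nhdsWithin (0 : ℝ) (Set.Ioi 0), γ t ∈ signCone f (Set.Iic (2 ^ s)) U := by
        refine nhdsWithin_le_nhds (hγ.continuousAt.eventually_mem ?_)
        exact (isOpen_signCone (Set.finite_Iic _)).mem_nhds (by simpa [γ] using hv)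
      have hpos : ∀ᶠ t in nhdsWithin (0 : ℝ) (Set.Ioi 0), 0 < t := self_mem_nhdsWithin
      obtain ⟨t, ht, ht0⟩ := (hev.and hpos).exists
      exact ⟨γ t, ht, by simp [γ, hv2, ht0.ne']⟩
    · exact ⟨v, hv, hv2⟩
  rcases lt_or_gt_of_ne hv2 with h | h
  · obtain ⟨i, j, hij, hj, hc⟩ := hf.exists_rotated_of_pos (U := fun r => ¬ U r) (v := -v)
      (by simpa [neg_mem_signCone] using hv) (by simpa using h) h2 (by simpa using h1)
    refine ⟨i, j, hij, hj, hc.symm.imp (fun h r hr => ?_) fun h r hr => ?_⟩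
    · exact not_iff_not.1 (h r hr)
    · rw [← h r hr, not_not]
  · exact hf.exists_rotated_of_pos hv h h1 h2

theorem orient_of_rotated (hf : IsRealization s f) {i j : ℕ} (hij : i < j) (hj : j ≤ 2 ^ s) {r : ℕ} (hr : r ≤ 2 ^ s) :
    (rotated s i j r → 0 ≤ orient (f i) (f j) (f r)) ∧
      (¬ rotated s i j r → orient (f i) (f j) (f r) ≤ 0) ∧
      (orient (f i) (f j) (f r) = 0 → r = i ∨ r = j) := by
  by_cases hri : r = i
  · subst hri; simp [orient]
  by_cases hrj : r = j
  · subst hrj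
    rw [show orient (f i) (f r) (f r) = 0 by rw [orient]; ring]
    simp
  obtain ⟨h1, h2⟩ := hf.above i j r hij hj hr hri hrj
  simp only [rotated, hri, hrj, false_or, ne_eq, not_false_eq_true, true_and]
  refine ⟨fun h => (h1 h).le, fun h => (h2 h).le, fun h => ?_⟩
  by_cases hA : Above s i j r
  · exact (h1 hA).ne' h
  · exact (h2 hA).ne h

/-- The vertical difference of the lines `ij` and `i'j'` is an affine function `m * x + c`. Its
signs at `i` and `j` determine the sign of `m` in one way, those at `i'` and `j'` in the opposite
way. So the lines coincide, and no three points are collinear. -/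
theorem rotated_injective (hf : IsRealization s f) {i j i' j' : ℕ} (hij : i < j) (hj : j ≤ 2 ^ s) (hij' : i' < j')
    (hj' : j' ≤ 2 ^ s)
    (h : (∀ r ∈ Set.Iic (2 ^ s), (rotated s i j r ↔ rotated s i' j' r)) ∨
      ∀ r ∈ Set.Iic (2 ^ s), (rotated s i j r ↔ ¬ rotated s i' j' r)) : i = i' ∧ j = j' := by
  have hi := hij.le.trans hj
  have hi' := hij'.le.trans hj'
  have hx := hf.lt i j hij hj
  have hx' := hf.lt i' j' hij' hj'
  have key : ∀ r, ((f j').1 - (f i').1) * orient (f i) (f j) (f r) -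
      ((f j).1 - (f i).1) * orient (f i') (f j') (f r) =
      (((f j).1 - (f i).1) * ((f j').2 - (f i').2) -
        ((f j').1 - (f i').1) * ((f j).2 - (f i).2)) * (f r).1 +
      (((f j').1 - (f i').1) * (((f j).2 - (f i).2) * (f i).1 - ((f j).1 - (f i).1) * (f i).2) -
        ((f j).1 - (f i).1) *
          (((f j').2 - (f i').2) * (f i').1 - ((f j').1 - (f i').1) * (f i').2)) := by
    intro r
    simp only [orient]
    ring
  generalize ((f j).1 - (f i).1) * ((f j').2 - (f i').2) -
        ((f j').1 - (f i').1) * ((f j).2 - (f i).2) = m at key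
  generalize (((f j').1 - (f i').1) * (((f j).2 - (f i).2) * (f i).1 -
    ((f j).1 - (f i).1) * (f i).2) - ((f j).1 - (f i).1) *
          (((f j').2 - (f i').2) * (f i').1 - ((f j').1 - (f i').1) * (f i').2)) = c at key
  have hd : 0 < (f j).1 - (f i).1 := by linarith
  have hd' : 0 < (f j').1 - (f i').1 := by linarith
  have ri : rotated s i j i := .inl rfl
  have rj : ¬ rotated s i j j := by simp [rotated]; omega
  have ri' : rotated s i' j' i' := .inl rfl
  have rj' : ¬ rotated s i' j' j' := by simp [rotated]; omega
  have z1 : orient (f i) (f j) (f i) = 0 := by simp [orient]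
  have z2 : orient (f i) (f j) (f j) = 0 := by rw [orient]; ring
  have z3 : orient (f i') (f j') (f i') = 0 := by simp [orient]
  have z4 : orient (f i') (f j') (f j') = 0 := by rw [orient]; ring
  have k1 := key i
  have k2 := key j
  have k3 := key i'
  have k4 := key j'
  rw [z1] at k1
  rw [z2] at k2
  rw [z3] at k3
  rw [z4] at k4
  obtain ⟨a1, a2, a3⟩ := hf.orient_of_rotated hij' hj' hi
  obtain ⟨b1, b2, b3⟩ := hf.orient_of_rotated hij' hj' hj
  obtain ⟨c1, c2, -⟩ := hf.orient_of_rotated hij hj hi'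
  obtain ⟨d1, d2, -⟩ := hf.orient_of_rotated hij hj hj'
  -- This step serves both cases: once `m = 0` and `c = 0`, the points `i` and `j` lie on the line
  -- `i'j'`.
  have fin (h1 : m ≤ 0) (h2 : 0 ≤ m) (hc1 : m * (f i).1 + c ≤ 0 ∨ m * (f j).1 + c ≤ 0)
      (hc2 : 0 ≤ m * (f i).1 + c ∨ 0 ≤ m * (f j).1 + c) :
      (i = i' ∨ i = j') ∧ (j = i' ∨ j = j') := by
    obtain rfl : m = 0 := le_antisymm h1 h2
    simp only [zero_mul, zero_add, or_self] at *
    obtain rfl : c = 0 := le_antisymm hc1 hc2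
    refine ⟨a3 ?_, b3 ?_⟩
    · have : ((f j).1 - (f i).1) * orient (f i') (f j') (f i) = 0 := by linarith
      simpa [hd.ne'] using this
    · have : ((f j).1 - (f i).1) * orient (f i') (f j') (f j) = 0 := by linarith
      simpa [hd.ne'] using this
  rcases h with h | h
  · have e1 := mul_nonneg hd.le (a1 ((h i hi).1 ri))
    have e2 := mul_nonpos_of_nonneg_of_nonpos hd.le (b2 fun h' => rj ((h j hj).2 h'))
    have e3 := mul_nonneg hd'.le (c1 ((h i' hi').2 ri'))
    have e4 := mul_nonpos_of_nonneg_of_nonpos hd'.le (d2 fun h' => rj' ((h j' hj').1 h'))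
    have m1 : 0 ≤ m * ((f j).1 - (f i).1) := by linarith
    have m2 : m * ((f j').1 - (f i').1) ≤ 0 := by linarith
    obtain ⟨f1, f2⟩ := fin (nonpos_of_mul_nonpos_left m2 hd') (nonneg_of_mul_nonneg_left m1 hd)
      (.inl (by linarith)) (.inr (by linarith))
    have n1 : i ≠ j' := fun e => rj' (e ▸ (h i hi).1 ri)
    have n2 : j ≠ i' := fun e => rj ((h j hj).2 (e ▸ ri'))
    omega
  · have e1 := mul_nonpos_of_nonneg_of_nonpos hd.le (a2 ((h i hi).1 ri))
    have e2 := mul_nonneg hd.le (b1 (by_contra fun h' => rj ((h j hj).2 h')))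
    have e3 := mul_nonpos_of_nonneg_of_nonpos hd'.le (c2 fun h' => (h i' hi').1 h' ri')
    have e4 := mul_nonneg hd'.le (d1 ((h j' hj').2 rj'))
    have m1 : m * ((f j).1 - (f i).1) ≤ 0 := by linarith
    have m2 : 0 ≤ m * ((f j').1 - (f i').1) := by linarith
    obtain ⟨f1, f2⟩ := fin (nonpos_of_mul_nonpos_left m1 hd) (nonneg_of_mul_nonneg_left m2 hd')
      (.inr (by linarith)) (.inl (by linarith))
    have n1 : i ≠ i' := fun e => (h i hi).1 ri (e ▸ ri')
    omega

end IsRealization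

/-! ### The dual arrangement of a realization -/

theorem nontrivial_Iic_two_pow (s : ℕ) : (Set.Iic (2 ^ s)).Nontrivial :=
  ⟨0, Nat.zero_le _, 1, Nat.one_le_two_pow, zero_ne_one⟩

namespace IsRealization

variable {s : ℕ} {f : ℕ → ℝ × ℝ}

theorem numEdges_of_isFaceCycle (hf : IsRealization s f) {U : ℕ → Prop} {T : Finset ℕ}
    (h : IsFaceCycle s U T) :
    numEdges (dualArrangement (f '' Set.Iic (2 ^ s))) (cell f ⊤ (Set.Iic (2 ^ s)) U) = T.card := by
  rw [numEdges_cell hf.injOn (nontrivial_Iic_two_pow s) (Set.finite_Iic _),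
    (hf.of_isFaceCycle h).1, Set.encard_coe_eq_coe_finsetCard]

theorem isFace_of_isFaceCycle (hf : IsRealization s f) {U : ℕ → Prop} {T : Finset ℕ}
    (h : IsFaceCycle s U T) :
    IsFace (dualArrangement (f '' Set.Iic (2 ^ s))) (cell f ⊤ (Set.Iic (2 ^ s)) U) :=
  (isFace_iff (nontrivial_Iic_two_pow s).nonempty (Set.finite_Iic _)).2
    ⟨U, (hf.of_isFaceCycle h).2, rfl⟩

theorem numEdges_rotated (hf : IsRealization s f) (hs : s ≠ 0) {i j : ℕ} (hij : i < j)
    (hj : j ≤ 2 ^ s) :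
    numEdges (dualArrangement (f '' Set.Iic (2 ^ s)))
      (cell f ⊤ (Set.Iic (2 ^ s)) (rotated s i j)) = edgeCount s i j := by
  obtain ⟨T, hT, hc⟩ := exists_faceCycle hs hij hj
  rw [hf.numEdges_of_isFaceCycle hT, hc]

theorem numEdges_true (hf : IsRealization s f) (hs : s ≠ 0) :
    numEdges (dualArrangement (f '' Set.Iic (2 ^ s)))
      (cell f ⊤ (Set.Iic (2 ^ s)) fun _ => True) = 3 := by
  obtain ⟨s, rfl⟩ := Nat.exists_eq_succ_of_ne_zero hs
  rw [hf.numEdges_of_isFaceCycle (isFaceCycle_true s)]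
  have := Nat.two_pow_pos s
  rw [Finset.card_eq_three.2 ⟨0, 2 ^ s, 2 * 2 ^ s, by omega, by omega, by omega, rfl⟩]
  rfl

theorem face_cases (hf : IsRealization s f) {F : Set ProjPlane}
    (hF : IsFace (dualArrangement (f '' Set.Iic (2 ^ s))) F) :
    F = cell f ⊤ (Set.Iic (2 ^ s)) (fun _ => True) ∨
      ∃ i j, i < j ∧ j ≤ 2 ^ s ∧ F = cell f ⊤ (Set.Iic (2 ^ s)) (rotated s i j) := by
  rw [isFace_iff (nontrivial_Iic_two_pow s).nonempty (Set.finite_Iic _)] at hF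
  obtain ⟨U, hU, rfl⟩ := hF
  by_cases h1 : ∃ i ≤ 2 ^ s, U i
  · by_cases h2 : ∃ j ≤ 2 ^ s, ¬ U j
    · obtain ⟨i, j, hij, hj, h⟩ := hf.exists_rotated hU h1 h2
      exact .inr ⟨i, j, hij, hj, cell_eq_of_iff h⟩
    · push Not at h2
      exact .inl (cell_eq_of_iff (.inl fun r hr => by simp [h2 r hr]))
  · push Not at h1
    exact .inl (cell_eq_of_iff (.inr fun r hr => by simp [h1 r hr]))

theorem numEdges_bounds (hf : IsRealization s f) (hs : s ≠ 0) {F : Set ProjPlane}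
    (hF : IsFace (dualArrangement (f '' Set.Iic (2 ^ s))) F) :
    ∃ n : ℕ, numEdges (dualArrangement (f '' Set.Iic (2 ^ s))) F = n ∧ 3 ≤ n ∧ n ≤ 5 := by
  rcases hf.face_cases hF with rfl | ⟨i, j, hij, hj, rfl⟩
  · exact ⟨3, hf.numEdges_true hs, by simp⟩
  · exact ⟨_, hf.numEdges_rotated hs hij hj, edgeCount_bounds hs hij hj⟩

theorem encard_pentagons (hf : IsRealization s f) (hs : s ≠ 0) :
    (pentagons (dualArrangement (f '' Set.Iic (2 ^ s)))).encard =
      ((pairs s).filter fun x => edgeCount s x.1 x.2 = 5).card := by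
  have himg : pentagons (dualArrangement (f '' Set.Iic (2 ^ s))) =
      (fun x : ℕ × ℕ => cell f ⊤ (Set.Iic (2 ^ s)) (rotated s x.1 x.2)) ''
        ((pairs s).filter fun x => edgeCount s x.1 x.2 = 5 : Finset (ℕ × ℕ)) := by
    ext F
    simp only [pentagons, Set.mem_ofPred_eq, Set.mem_image, Finset.mem_coe, Finset.mem_filter,
      mem_pairs]
    constructor
    · rintro ⟨hF, h5⟩
      rcases hf.face_cases hF with rfl | ⟨i, j, hij, hj, rfl⟩
      · rw [hf.numEdges_true hs] at h5
        exact absurd h5 (by norm_num)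
      · rw [hf.numEdges_rotated hs hij hj] at h5
        exact ⟨(i, j), ⟨⟨hij, hj⟩, by exact_mod_cast h5⟩, rfl⟩
    · rintro ⟨⟨i, j⟩, ⟨⟨hij, hj⟩, h5⟩, rfl⟩
      obtain ⟨T, hT, -⟩ := exists_faceCycle hs hij hj
      refine ⟨hf.isFace_of_isFaceCycle hT, ?_⟩
      rw [hf.numEdges_rotated hs hij hj, h5]
      rfl
  rw [himg, Set.InjOn.encard_image, Set.encard_coe_eq_coe_finsetCard]
  rintro ⟨i, j⟩ hx ⟨i', j'⟩ hx' e
  rw [Finset.mem_coe, Finset.mem_filter, mem_pairs] at hx hx'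
  obtain ⟨T, hT, -⟩ := exists_faceCycle hs hx.1.1 hx.1.2
  obtain ⟨v, hv⟩ := (hf.of_isFaceCycle hT).2
  have hX := (mk_mem_cell (f := f) (H := ⊤)
    (ne_zero_of_mem_signCone (nontrivial_Iic_two_pow s).nonempty hv)).2 ⟨trivial, .inl hv⟩
  have hX' := hX
  simp only at e
  rw [e] at hX'
  obtain ⟨rfl, rfl⟩ := hf.rotated_injective hx.1.1 hx.1.2 hx'.1.1 hx'.1.2
    (iff_or_iff_not_of_mem_cell hX hX')
  rfl

theorem encard_image (hf : IsRealization s f) : (f '' Set.Iic (2 ^ s)).encard = 2 ^ s + 1 := by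
  rw [hf.injOn.encard_image, ← Finset.coe_Iic, Set.encard_coe_eq_coe_finsetCard, Nat.card_Iic]
  norm_cast

end IsRealization

/-! ### Koch chains have the order type of `Above` -/

theorem orient_neg_of_notMem_upperShadow {a b r : ℝ × ℝ} (h1 : a.1 < r.1) (h2 : r.1 < b.1)
    (h : r ∉ upperShadow a b) : orient a b r < 0 := by
  have hd : 0 < b.1 - a.1 := by linarith
  by_contra ho
  refine h ⟨a + ((r.1 - a.1) / (b.1 - a.1)) • (b - a), ?_, ?_, ?_⟩
  · rw [segment_eq_image']
    exact ⟨_, ⟨div_nonneg (by linarith) hd.le, (div_le_one hd).2 (by linarith)⟩, rfl⟩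
  · simp only [Prod.fst_add, Prod.smul_fst, Prod.fst_sub, smul_eq_mul, div_mul_cancel₀ _ hd.ne']
    ring
  · simp only [Prod.snd_add, Prod.smul_snd, Prod.snd_sub, smul_eq_mul]
    rw [div_mul_eq_mul_div, ← le_sub_iff_add_le', div_le_iff₀ hd]
    rw [orient] at ho
    linarith

theorem orient_nonneg_of_mem_upperShadow {a b r : ℝ × ℝ} (hab : a.1 < b.1)
    (h : r ∈ upperShadow a b) : a.1 ≤ r.1 ∧ r.1 ≤ b.1 ∧ 0 ≤ orient a b r := by
  obtain ⟨z, hz, h1, h2⟩ := h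
  rw [segment_eq_image'] at hz
  obtain ⟨t, ⟨ht0, ht1⟩, rfl⟩ := hz
  simp only [Prod.fst_add, Prod.smul_fst, Prod.fst_sub, smul_eq_mul] at h1
  simp only [Prod.snd_add, Prod.smul_snd, Prod.snd_sub, smul_eq_mul] at h2
  have hd : 0 < b.1 - a.1 := by linarith
  have e1 := mul_nonneg ht0 hd.le
  have e2 := mul_le_of_le_one_left hd.le ht1
  refine ⟨by linarith, by linarith, ?_⟩
  have e3 := mul_le_mul_of_nonneg_left h2 hd.le
  rw [orient, ← h1]
  linarith

/-- The copy map has determinant `ε / 2`. The exchange of `a` and `b` restores the left-to-right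
order, at the price of the minus sign that swaps above and below. -/
theorem orient_leftCopy (ε : ℝ) (a b c : ℝ × ℝ) :
    orient (leftCopy ε a) (leftCopy ε b) (leftCopy ε c) = -(ε / 2) * orient b a c := by
  simp only [orient, leftCopy, placeLeft, flatten]
  ring

theorem orient_rightCopy (ε : ℝ) (a b c : ℝ × ℝ) :
    orient (rightCopy ε a) (rightCopy ε b) (rightCopy ε c) = -(ε / 2) * orient b a c := by
  simp only [orient, rightCopy, placeRight, flatten]
  ring

theorem orient_swap (a b c : ℝ × ℝ) : orient a b c = -orient a c b := by
  simp only [orient]; ring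

theorem orient_rotate (a b c : ℝ × ℝ) : orient a b c = orient c a b := by
  simp only [orient]; ring

theorem leftCopy_vLeft (ε : ℝ) : leftCopy ε vLeft = vMid := by
  norm_num [leftCopy, placeLeft, flatten, vLeft, vMid]

theorem leftCopy_vRight (ε : ℝ) : leftCopy ε vRight = vLeft := by
  norm_num [leftCopy, placeLeft, flatten, vLeft, vRight]

theorem rightCopy_vLeft (ε : ℝ) : rightCopy ε vLeft = vRight := by
  norm_num [rightCopy, placeRight, flatten, vLeft, vRight]

theorem rightCopy_vRight (ε : ℝ) : rightCopy ε vRight = vMid := by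
  norm_num [rightCopy, placeRight, flatten, vRight, vMid]

theorem exists_realization_one : ∃ f, IsRealization 1 f ∧
    f '' Set.Iic (2 ^ 1) = {vLeft, vMid, vRight} ∧ f 0 = vLeft ∧ f (2 ^ 1) = vRight := by
  let f : ℕ → ℝ × ℝ := fun r => if r = 0 then vLeft else if r = 1 then vMid else vRight
  have f0 : f 0 = vLeft := rfl
  have f1 : f 1 = vMid := rfl
  have f2 : f 2 = vRight := rfl
  refine ⟨f, ⟨fun i j hij hj => ?_, fun p q r hpq hq hr h1 h2 => ?_⟩, ?_, rfl, rfl⟩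
  · rw [pow_one] at hj
    obtain ⟨rfl, rfl⟩ | ⟨rfl, rfl⟩ | ⟨rfl, rfl⟩ :
      (i = 0 ∧ j = 1) ∨ (i = 0 ∧ j = 2) ∨ (i = 1 ∧ j = 2) := by omega
    all_goals simp only [f0, f1, f2]; norm_num [vLeft, vMid, vRight]
  · rw [pow_one] at hq hr
    obtain ⟨rfl, rfl, rfl⟩ | ⟨rfl, rfl, rfl⟩ | ⟨rfl, rfl, rfl⟩ :
      (p = 0 ∧ q = 1 ∧ r = 2) ∨ (p = 0 ∧ q = 2 ∧ r = 1) ∨ (p = 1 ∧ q = 2 ∧ r = 0) := by omega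
    all_goals
      simp only [f0, f1, f2]
      norm_num [vLeft, vMid, vRight, Above, orient]
  · ext x
    simp only [Set.mem_image, Set.mem_Iic, pow_one, Set.mem_insert_iff, Set.mem_singleton_iff]
    constructor
    · rintro ⟨r, hr, rfl⟩
      interval_cases r
      · exact .inl rfl
      · exact .inr (.inl rfl)
      · exact .inr (.inr rfl)
    · rintro (rfl | rfl | rfl)
      · exact ⟨0, by simp, rfl⟩
      · exact ⟨1, by simp, rfl⟩
      · exact ⟨2, by simp, rfl⟩

/-- The numberings of the two copies are reversed and joined at `vMid`; the positions of the end
points are carried along in the induction for this purpose. Triples inside a copy are inherited. -/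
theorem IsKochChain.exists_realization {s : ℕ} {P : Set (ℝ × ℝ)} (h : IsKochChain s P) :
    s ≠ 0 ∧ ∃ f, IsRealization s f ∧ f '' Set.Iic (2 ^ s) = P ∧ f 0 = vLeft ∧ f (2 ^ s) = vRight := by
  induction h with
  | base => exact ⟨one_ne_zero, exists_realization_one⟩
  | step s Q₁ Q₂ ε₁ ε₂ hQ₁ hQ₂ hε₁ hε₂ horder₁ horder₂ hinterior hshadow ih₁ ih₂ =>
    obtain ⟨-, f₁, hf₁, rfl, h₁0, h₁1⟩ := ih₁
    obtain ⟨-, f₂, hf₂, rfl, h₂0, h₂1⟩ := ih₂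
    refine ⟨s.succ_ne_zero, ?_⟩
    have hm := Nat.two_pow_pos s
    have e := two_pow_succ' s
    let f : ℕ → ℝ × ℝ := fun r =>
      if r ≤ 2 ^ s then leftCopy ε₁ (f₁ (2 ^ s - r)) else rightCopy ε₂ (f₂ (2 * 2 ^ s - r))
    have hfl : ∀ r ≤ 2 ^ s, f r = leftCopy ε₁ (f₁ (2 ^ s - r)) := fun r hr => if_pos hr
    have hmid : f (2 ^ s) = vMid := by
      rw [hfl _ le_rfl, Nat.sub_self, h₁0, leftCopy_vLeft]
    have hfr : ∀ r, 2 ^ s ≤ r → f r = rightCopy ε₂ (f₂ (2 * 2 ^ s - r)) := by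
      intro r hr
      rcases hr.eq_or_lt with rfl | hr
      · rw [hmid, two_mul, Nat.add_sub_cancel, h₂1, rightCopy_vRight]
      · exact if_neg (by omega)
    have hltl : ∀ i j, i < j → j ≤ 2 ^ s → (f i).1 < (f j).1 := by
      intro i j hij hj
      rw [hfl i (by omega), hfl j hj]
      refine horder₁ _ (Set.mem_image_of_mem f₁ ?_) _ (Set.mem_image_of_mem f₁ ?_)
        (hf₁.lt _ _ ?_ ?_)
      · exact Nat.sub_le _ _
      · exact Nat.sub_le _ _
      · omega
      · omega
    have hltr : ∀ i j, i < j → 2 ^ s ≤ i → j ≤ 2 * 2 ^ s → (f i).1 < (f j).1 := by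
      intro i j hij hi hj
      rw [hfr i hi, hfr j (by omega)]
      refine horder₂ _ (Set.mem_image_of_mem f₂ ?_) _ (Set.mem_image_of_mem f₂ ?_)
        (hf₂.lt _ _ ?_ ?_)
      · rw [Set.mem_Iic]; omega
      · rw [Set.mem_Iic]; omega
      · omega
      · omega
    have hlt : ∀ i j, i < j → j ≤ 2 * 2 ^ s → (f i).1 < (f j).1 := by
      intro i j hij hj
      rcases le_or_gt j (2 ^ s) with h1 | h1
      · exact hltl i j hij h1
      rcases le_or_gt (2 ^ s) i with h2 | h2
      · exact hltr i j hij h2 hj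
      · exact (hltl i _ h2 le_rfl).trans (hltr _ j h1 le_rfl hj)
    have hmeml : ∀ r ≤ 2 ^ s, f r ∈ leftCopy ε₁ '' (f₁ '' Set.Iic (2 ^ s)) := by
      intro r hr
      rw [hfl r hr]
      exact Set.mem_image_of_mem _ (Set.mem_image_of_mem _ (Nat.sub_le _ _))
    have hmemr : ∀ r, 2 ^ s ≤ r → f r ∈ rightCopy ε₂ '' (f₂ '' Set.Iic (2 ^ s)) := by
      intro r hr
      rw [hfr r hr]
      exact Set.mem_image_of_mem _ (Set.mem_image_of_mem _ (by rw [Set.mem_Iic]; omega))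
    -- This is the shadow condition. It settles every triple that is not contained in one copy,
    -- since the extreme points of such a triple lie strictly on both sides of the middle.
    have hmix : ∀ a r b, a < r → r < b → a < 2 ^ s → 2 ^ s < b → b ≤ 2 * 2 ^ s →
        orient (f a) (f b) (f r) < 0 := by
      intro a r b har hrb ham hmb hb
      have e1 := hlt a r har (by omega)
      have e2 := hlt r b hrb hb
      have e3 := hlt a _ ham (by omega)
      have e4 := hlt _ b hmb hb
      refine orient_neg_of_notMem_upperShadow e1 e2 (hshadow _ (hmeml a ham.le) _ (hmemr b hmb.le)
        ?_ ?_ _ ?_ ?_ ?_)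
      · rw [← hmid]; exact fun h => e3.ne (congrArg Prod.fst h)
      · rw [← hmid]; exact fun h => e4.ne' (congrArg Prod.fst h)
      · rcases le_total r (2 ^ s) with h | h
        · exact .inl (hmeml r h)
        · exact .inr (hmemr r h)
      · exact fun h => e1.ne' (congrArg Prod.fst h)
      · exact fun h => e2.ne (congrArg Prod.fst h)
    refine ⟨f, ⟨fun i j hij hj => hlt i j hij (e ▸ hj), fun p q r hpq hq hr h1 h2 => ?_⟩, ?_, ?_, ?_⟩
    · rw [e] at hq hr
      rcases le_or_gt q (2 ^ s) with hqm | hqm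
      · rw [above_left (by omega) hqm]
        rcases le_or_gt r (2 ^ s) with hrm | hrm
        · obtain ⟨k1, k2⟩ := hf₁.above (2 ^ s - q) (2 ^ s - p) (2 ^ s - r) (by omega) (by omega)
            (by omega) (by omega) (by omega)
          rw [above_symm] at k1 k2
          rw [hfl p (by omega), hfl q hqm, hfl r hrm, orient_leftCopy]
          simp only [hrm, true_imp_iff, not_not]
          exact ⟨fun h => mul_pos_of_neg_of_neg (by linarith) (k2 h),
            fun h => mul_neg_of_neg_of_pos (by linarith) (k1 h)⟩
        · have := hmix p q r hpq (by omega) (by omega) hrm hr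
          rw [orient_swap]
          exact ⟨fun _ => by linarith, fun h => absurd (fun h' => absurd h' (by omega)) h⟩
      rcases le_or_gt (2 ^ s) p with hpm | hpm
      · rw [above_right hpm (by omega) hpq.ne]
        rcases le_or_gt (2 ^ s) r with hrm | hrm
        · obtain ⟨k1, k2⟩ := hf₂.above (2 * 2 ^ s - q) (2 * 2 ^ s - p) (2 * 2 ^ s - r) (by omega)
            (by omega) (by omega) (by omega) (by omega)
          rw [above_symm] at k1 k2
          rw [hfr p hpm, hfr q (by omega), hfr r hrm, orient_rightCopy]
          simp only [hrm, true_imp_iff, not_not]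
          exact ⟨fun h => mul_pos_of_neg_of_neg (by linarith) (k2 h),
            fun h => mul_neg_of_neg_of_pos (by linarith) (k1 h)⟩
        · have := hmix r p q (by omega) hpq hrm (by omega) hq
          rw [orient_rotate, orient_swap]
          exact ⟨fun _ => by linarith, fun h => absurd (fun h' => absurd h' (by omega)) h⟩
      · rw [above_mixed hpm hqm, not_not]
        refine ⟨fun h => ?_, fun h => hmix p r q h.1 h.2 hpm hqm hq⟩
        rcases lt_or_gt_of_ne h1 with h' | h'
        · have := hmix r p q h' hpq (by omega) hqm hq
          rw [orient_rotate, orient_swap]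
          linarith
        · have := hmix p q r hpq (by omega) hpm (by omega) hr
          rw [orient_swap]
          linarith
    · ext x
      simp only [Set.mem_union, Set.mem_image, Set.mem_Iic]
      constructor
      · rintro ⟨r, hr, rfl⟩
        rcases le_total r (2 ^ s) with h | h
        · exact .inl ⟨_, ⟨_, Nat.sub_le _ _, rfl⟩, (hfl r h).symm⟩
        · exact .inr ⟨_, ⟨2 * 2 ^ s - r, by omega, rfl⟩, (hfr r h).symm⟩
      · rintro (⟨-, ⟨r, hr, rfl⟩, rfl⟩ | ⟨-, ⟨r, hr, rfl⟩, rfl⟩)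
        · exact ⟨2 ^ s - r, by omega, by rw [hfl _ (by omega), Nat.sub_sub_self hr]⟩
        · exact ⟨2 * 2 ^ s - r, by omega, by rw [hfr _ (by omega), Nat.sub_sub_self (by omega)]⟩
    · rw [hfl 0 (by omega), Nat.sub_zero, h₁1, leftCopy_vRight]
    · rw [e, hfr _ (by omega), Nat.sub_self, h₂0, rightCopy_vLeft]

/-! ### Existence -/

theorem mem_interior_triangle {p : ℝ × ℝ} (h1 : p.2 < 0) (h2 : 0 < p.1 + p.2 + 1)
    (h3 : 0 < -p.1 + p.2 + 1) :
    p ∈ interior (convexHull ℝ ({vLeft, vMid, vRight} : Set (ℝ × ℝ))) := by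
  refine interior_maximal (t := {q : ℝ × ℝ | q.2 < 0 ∧ 0 < q.1 + q.2 + 1 ∧ 0 < -q.1 + q.2 + 1})
    ?_ ?_ ⟨h1, h2, h3⟩
  · rintro q ⟨h1, h2, h3⟩
    -- The weights are the barycentric coordinates of `q`.
    have := (convex_convexHull ℝ ({vLeft, vMid, vRight} : Set (ℝ × ℝ))).sum_mem
      (t := Finset.univ) (w := ![(1 + q.2 - q.1) / 2, -q.2, (1 + q.2 + q.1) / 2])
      (z := ![vLeft, vMid, vRight]) ?_ ?_ ?_
    · convert this using 1
      simp only [Fin.sum_univ_three, vLeft, vMid, vRight]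
      ext <;> simp
      ring
    · intro i _
      fin_cases i <;> simp <;> linarith
    · simp only [Fin.sum_univ_three]
      simp
      ring
    · intro i _
      refine subset_convexHull _ _ ?_
      fin_cases i <;> simp
  · exact (isOpen_lt continuous_snd continuous_const).and
      ((isOpen_lt continuous_const (by fun_prop)).and (isOpen_lt continuous_const (by fun_prop)))

open Filter Topology in
theorem eventually_lt_of_continuous {g h : ℝ → ℝ} (hg : Continuous g) (hh : Continuous h)
    (h0 : g 0 < h 0) : ∀ᶠ ε in 𝓝[>] (0 : ℝ), g ε < h ε :=
  nhdsWithin_le_nhds (hg.continuousAt.eventually_lt hh.continuousAt h0)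

open Filter Topology in
-- At `ε = 0` the copies degenerate to point sets on the two lower sides of the triangle. Finitely
-- many strict inequalities hold there and persist for small `ε > 0`. Staying inside the two lower
-- sides is not of this kind: it holds for every `ε > 0`, because the inner points of the chain have
-- negative height, which is why this is part of the induction.
theorem exists_isKochChain (s : ℕ) : ∃ P, IsKochChain (s + 1) P ∧
    ∀ q ∈ P, q = vLeft ∨ q = vRight ∨ (q.2 < 0 ∧ -1 < q.1 ∧ q.1 < 1) := by
  induction s with
  | zero =>
    refine ⟨_, .base, fun q hq => ?_⟩
    rcases hq with rfl | rfl | rfl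
    · exact .inl rfl
    · exact .inr (.inr (by norm_num [vMid]))
    · exact .inr (.inl rfl)
  | succ s ih =>
    obtain ⟨P, hP, hPq⟩ := ih
    obtain ⟨-, f, hf, hfP, -, -⟩ := hP.exists_realization
    have hfin : P.Finite := hfP ▸ (Set.finite_Iic _).image f
    have hinj : ∀ q ∈ P, ∀ q' ∈ P, q ≠ q' → q.1 ≠ q'.1 := by
      rw [← hfP]
      rintro - ⟨i, hi, rfl⟩ - ⟨j, hj, rfl⟩ hne
      exact hf.fst_ne hi hj fun e => hne (by rw [e])
    have hge : ∀ q ∈ P, q ≠ vLeft → -1 < q.1 := by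
      intro q hq hne
      rcases hPq q hq with h | rfl | h
      · exact absurd h hne
      · norm_num [vRight]
      · exact h.2.1
    have hle : ∀ q ∈ P, q ≠ vRight → q.1 < 1 := by
      intro q hq hne
      rcases hPq q hq with rfl | h | h
      · norm_num [vLeft]
      · exact absurd h hne
      · exact h.2.2
    have hge' : ∀ q ∈ P, -1 ≤ q.1 := by
      intro q hq
      by_cases h : q = vLeft
      · simp [h, vLeft]
      · exact (hge q hq h).le
    have hle' : ∀ q ∈ P, q.1 ≤ 1 := by
      intro q hq
      by_cases h : q = vRight
      · simp [h, vRight]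
      · exact (hle q hq h).le
    have hcl : ∀ q : ℝ × ℝ, Continuous fun ε => leftCopy ε q := fun q => by
      unfold leftCopy placeLeft flatten; fun_prop
    have hcr : ∀ q : ℝ × ℝ, Continuous fun ε => rightCopy ε q := fun q => by
      unfold rightCopy placeRight flatten; fun_prop
    have hco : ∀ a b c : ℝ → ℝ × ℝ, Continuous a → Continuous b → Continuous c →
        Continuous fun ε => orient (a ε) (b ε) (c ε) := by
      intro a b c ha hb hc
      unfold orient
      fun_prop
    have E1 : ∀ᶠ ε in 𝓝[>] (0 : ℝ), ∀ q ∈ P, ∀ q' ∈ P, q.1 < q'.1 →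
        (leftCopy ε q').1 < (leftCopy ε q).1 ∧ (rightCopy ε q').1 < (rightCopy ε q).1 := by
      refine (eventually_all_finite hfin).2 fun q _ => (eventually_all_finite hfin).2 fun q' _ =>
        eventually_imp_distrib_left.2 fun h => ?_
      refine (eventually_lt_of_continuous (hcl q').fst (hcl q).fst ?_).and
        (eventually_lt_of_continuous (hcr q').fst (hcr q).fst ?_)
      · simp only [leftCopy, placeLeft, flatten]; linarith
      · simp only [rightCopy, placeRight, flatten]; linarith
    have E2 : ∀ᶠ ε in 𝓝[>] (0 : ℝ), ∀ q ∈ P, q.2 < 0 ∧ -1 < q.1 ∧ q.1 < 1 →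
        (leftCopy ε q).2 < 0 ∧ (rightCopy ε q).2 < 0 := by
      refine (eventually_all_finite hfin).2 fun q _ => eventually_imp_distrib_left.2 fun h => ?_
      refine (eventually_lt_of_continuous (hcl q).snd continuous_const ?_).and
        (eventually_lt_of_continuous (hcr q).snd continuous_const ?_)
      · simp only [leftCopy, placeLeft, flatten]; linarith
      · simp only [rightCopy, placeRight, flatten]; linarith
    -- On the degenerate V shape, a point of the side of `a` is either left of `a` or strictly below
    -- the line `ab`; likewise on the side of `b`. The excluded values are the preimages of `vMid`.
    have E3 : ∀ᶠ ε in 𝓝[>] (0 : ℝ), ∀ a ∈ P, ∀ b ∈ P, ∀ r ∈ P, a ≠ vLeft → b ≠ vRight →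
        (leftCopy ε a).1 < (rightCopy ε b).1 ∧
        (r ≠ a → leftCopy ε r ∉ upperShadow (leftCopy ε a) (rightCopy ε b)) ∧
        (r ≠ b → rightCopy ε r ∉ upperShadow (leftCopy ε a) (rightCopy ε b)) := by
      refine (eventually_all_finite hfin).2 fun a ha => (eventually_all_finite hfin).2 fun b hb =>
        (eventually_all_finite hfin).2 fun r hr => eventually_imp_distrib_left.2 fun ha' =>
        eventually_imp_distrib_left.2 fun hb' => ?_
      have a1 := hge a ha ha'
      have b1 := hle b hb hb'
      have r1 := hge' r hr
      have r2 := hle' r hr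
      have F0 : ∀ᶠ ε in 𝓝[>] (0 : ℝ), (leftCopy ε a).1 < (rightCopy ε b).1 := by
        refine eventually_lt_of_continuous (hcl a).fst (hcr b).fst ?_
        simp only [leftCopy, placeLeft, rightCopy, placeRight, flatten]
        linarith
      have F1 : ∀ᶠ ε in 𝓝[>] (0 : ℝ), r ≠ a → ((leftCopy ε r).1 < (leftCopy ε a).1 ∨
          orient (leftCopy ε a) (rightCopy ε b) (leftCopy ε r) < 0) := by
        refine eventually_imp_distrib_left.2 fun hra => ?_
        rcases lt_or_gt_of_ne (hinj r hr a ha hra) with h | h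
        · refine (eventually_lt_of_continuous (hco _ _ _ (hcl a) (hcr b) (hcl r))
            continuous_const ?_).mono fun _ => .inr
          simp only [orient, leftCopy, placeLeft, rightCopy, placeRight, flatten]
          nlinarith [mul_pos (sub_pos.2 h) (sub_pos.2 b1)]
        · refine (eventually_lt_of_continuous (hcl r).fst (hcl a).fst ?_).mono fun _ => .inl
          simp only [leftCopy, placeLeft, flatten]
          linarith
      have F2 : ∀ᶠ ε in 𝓝[>] (0 : ℝ), r ≠ b → ((rightCopy ε b).1 < (rightCopy ε r).1 ∨
          orient (leftCopy ε a) (rightCopy ε b) (rightCopy ε r) < 0) := by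
        refine eventually_imp_distrib_left.2 fun hrb => ?_
        rcases lt_or_gt_of_ne (hinj r hr b hb hrb) with h | h
        · refine (eventually_lt_of_continuous (hcr b).fst (hcr r).fst ?_).mono fun _ => .inl
          simp only [rightCopy, placeRight, flatten]
          linarith
        · refine (eventually_lt_of_continuous (hco _ _ _ (hcl a) (hcr b) (hcr r))
            continuous_const ?_).mono fun _ => .inr
          simp only [orient, leftCopy, placeLeft, rightCopy, placeRight, flatten]
          nlinarith [mul_pos (sub_pos.2 h) (sub_pos.2 a1)]
      filter_upwards [F0, F1, F2] with ε h0 h1 h2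
      refine ⟨h0, fun hne hmem => ?_, fun hne hmem => ?_⟩
      · obtain ⟨k1, -, k3⟩ := orient_nonneg_of_mem_upperShadow h0 hmem
        rcases h1 hne with h | h <;> linarith
      · obtain ⟨-, k2, k3⟩ := orient_nonneg_of_mem_upperShadow h0 hmem
        rcases h2 hne with h | h <;> linarith
    have E0 : ∀ᶠ ε in 𝓝[>] (0 : ℝ), 0 < ε := self_mem_nhdsWithin
    obtain ⟨ε, hε, e1, e2, e3⟩ := (E0.and (E1.and (E2.and E3))).exists
    have hcases : ∀ p ∈ leftCopy ε '' P ∪ rightCopy ε '' P,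
        p ∈ ({vLeft, vMid, vRight} : Set (ℝ × ℝ)) ∨
          (p.2 < 0 ∧ 0 < p.1 + p.2 + 1 ∧ 0 < -p.1 + p.2 + 1) := by
      rintro - (⟨q, hq, rfl⟩ | ⟨q, hq, rfl⟩)
      · rcases hPq q hq with rfl | rfl | h
        · left; rw [leftCopy_vLeft]; simp
        · left; rw [leftCopy_vRight]; simp
        · have := mul_neg_of_pos_of_neg hε h.1
          refine .inr ⟨(e2 q hq h).1, ?_, ?_⟩ <;>
            simp only [leftCopy, placeLeft, flatten] <;> linarith
      · rcases hPq q hq with rfl | rfl | h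
        · left; rw [rightCopy_vLeft]; simp
        · left; rw [rightCopy_vRight]; simp
        · have := mul_neg_of_pos_of_neg hε h.1
          refine .inr ⟨(e2 q hq h).2, ?_, ?_⟩ <;>
            simp only [rightCopy, placeRight, flatten] <;> linarith
    refine ⟨_, .step (s + 1) P P ε ε hP hP hε hε (fun q hq q' hq' h => (e1 q hq q' hq' h).1)
      (fun q hq q' hq' h => (e1 q hq q' hq' h).2) (fun p hp hne => ?_) ?_, fun p hp => ?_⟩
    · obtain ⟨h1, h2, h3⟩ := (hcases p hp).resolve_left hne
      exact mem_interior_triangle h1 h2 h3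
    · rintro - ⟨a, ha, rfl⟩ - ⟨b, hb, rfl⟩ hna hnb p hp hpa hpb
      have ha' : a ≠ vLeft := by rintro rfl; exact hna (leftCopy_vLeft ε)
      have hb' : b ≠ vRight := by rintro rfl; exact hnb (rightCopy_vRight ε)
      rcases hp with ⟨r, hr, rfl⟩ | ⟨r, hr, rfl⟩
      · exact (e3 a ha b hb r hr ha' hb').2.1 fun h => hpa (by rw [h])
      · exact (e3 a ha b hb r hr ha' hb').2.2 fun h => hpb (by rw [h])
    · rcases hcases p hp with (rfl | rfl | rfl) | h
      · exact .inl rfl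
      · exact .inr (.inr (by norm_num [vMid]))
      · exact .inr (.inl rfl)
      · exact .inr (.inr ⟨h.1, by linarith, by linarith⟩)

end Koch

/-! ### The main theorem. -/

theorem mainTheorem1 :
    -- the Koch chains exist
    (∀ s : ℕ, 1 ≤ s → ∃ P, Koch.IsKochChain s P) ∧
    -- every realization has `2 ^ s + 1` points, and as many dual lines
    (∀ (s : ℕ) (P : Set (ℝ × ℝ)), Koch.IsKochChain s P →
      P.encard = 2 ^ s + 1 ∧ (Koch.dualArrangement P).encard = 2 ^ s + 1) ∧
    -- the faces of the dual Koch arrangement for `s ≥ 3`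
    (∀ (s : ℕ) (P : Set (ℝ × ℝ)), 3 ≤ s → Koch.IsKochChain s P →
      (Koch.pentagons (Koch.dualArrangement P)).encard = ((3 * 2 ^ (s - 1) - 3 : ℕ) : ℕ∞) ∧
      (∀ F, Koch.IsFace (Koch.dualArrangement P) F →
        F ∉ Koch.pentagons (Koch.dualArrangement P) →
          Koch.numEdges (Koch.dualArrangement P) F = 3 ∨
          Koch.numEdges (Koch.dualArrangement P) F = 4) ∧
      (∀ F, Koch.IsFace (Koch.dualArrangement P) F →
        Koch.numEdges (Koch.dualArrangement P) F ≤ 5)) ∧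
    -- the formula also holds for `s = 1`
    (∀ P : Set (ℝ × ℝ), Koch.IsKochChain 1 P →
      (Koch.pentagons (Koch.dualArrangement P)).encard
        = ((3 * 2 ^ (1 - 1) - 3 : ℕ) : ℕ∞)) ∧
    -- but it fails for `s = 2`
    (∀ P : Set (ℝ × ℝ), Koch.IsKochChain 2 P →
      (Koch.pentagons (Koch.dualArrangement P)).encard
        ≠ ((3 * 2 ^ (2 - 1) - 3 : ℕ) : ℕ∞)) := by
  refine ⟨fun s hs => ?_, fun s P hP => ?_, fun s P hs hP => ?_, fun P hP => ?_, fun P hP => ?_⟩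
  · obtain ⟨s, rfl⟩ := Nat.exists_eq_add_of_le' hs
    obtain ⟨P, hP, -⟩ := Koch.exists_isKochChain s
    exact ⟨P, hP⟩
  · obtain ⟨-, f, hf, rfl, -, -⟩ := hP.exists_realization
    rw [Koch.dualArrangement, Koch.dualLine_injective.encard_image]
    exact ⟨hf.encard_image, hf.encard_image⟩
  · obtain ⟨hs0, f, hf, rfl, -, -⟩ := hP.exists_realization
    refine ⟨?_, fun F hF hF5 => ?_, fun F hF => ?_⟩
    · rw [hf.encard_pentagons hs0, Koch.card_pentagon_pairs hs]
    · obtain ⟨n, hn, h3, h5⟩ := hf.numEdges_bounds hs0 hF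
      have h5' : n ≠ 5 := fun e => hF5 ⟨hF, by rw [hn, e]; rfl⟩
      obtain rfl | rfl : n = 3 ∨ n = 4 := by omega
      · exact .inl hn
      · exact .inr hn
    · obtain ⟨n, hn, h3, h5⟩ := hf.numEdges_bounds hs0 hF
      rw [hn]
      exact_mod_cast h5
  · obtain ⟨hs0, f, hf, rfl, -, -⟩ := hP.exists_realization
    rw [hf.encard_pentagons hs0, Koch.card_pentagon_pairs_one]
    rfl
  · obtain ⟨hs0, f, hf, rfl, -, -⟩ := hP.exists_realization
    rw [hf.encard_pentagons hs0, Koch.card_pentagon_pairs_two]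
    norm_num
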